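/- **Setting.** Let $m\in\{2,3\}$ and let $\rho,\nu:\mathbb R^m\to(0,\infty)$ be real analytic; put $c=\sqrt{\nu/\rho}$. Fix $x_0\in\mathbb R^m$ and write $\rho_0=\rho(x_0)$, $c_0=c(x_0)$. Let $\tau(x)$ be the least travel time at speed $c$ from $x_0$ to $x$, i.e. the infimum of $\int_0^1|\gamma'(s)|/c(\gamma(s))\,ds$ over $C^1$ paths $\gamma$ from $x_0$ to $x$. For a unit vector $\omega$ let $x(\tau,\omega)$ denote the ray from $x_0$ with take-off direction $\omega$, i.e. the solution of $\frac{dx}{d\tau}=c(x)\frac{p}{|p|}$, $\frac{dp}{d\tau}=-|p|\nabla c(x)$, $x(0)=x_0$, $p(0)=\omega/c_0$. Let $\bar T>0$ be such that there is no caustic other than $x_0$ before time $\bar T$: all rays exist on $[0,\bar T)$, $x(\tau,\omega)=X(\tau\omega)$ for a smooth injective map $X$ on the ball $\{|y|<\bar T\}$, and the derivative of $X$ is invertible everywhere on this ball. Let $v_0$ be a $C^1$ function on $\{\tau<\bar T\}$ that satisfies there the transport equation $$4\nu\,\tau\,\nabla\tau\cdot\nabla v_0+\big[\nabla\cdot(\nu\nabla\tau^2)-2m\rho\big]v_0=0,\qquad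 v_0(x_0)=\frac{1}{2\rho_0c_0^m\pi^{(m-1)/2}},$$ and let $$G_0(t,x)=v_0(x)\,f_+^{-\frac{m-1}{2}}[t^2-\tau^2(x)]$$ be the leading Hadamard term. Here $\lambda!=\Gamma(\lambda+1)$, $f_+^\lambda(\varsigma)=\varsigma_+^\lambda/\lambda!$ for $\lambda>-1$, and $(f_+^{\lambda})'=f_+^{\lambda-1}$ defines $f_+^\lambda$ for the other real $\lambda$; integrals of $f_+^\lambda[s-\tau^2(x)]$ with $\lambda\le-1$ are understood as the corresponding derivatives with respect to $s$ of absolutely convergent integrals, taken at $s=t^2$. Let $u^1\in C_c^2(\mathbb R^m)$ and $u^2\in C_c^1(\mathbb R^m)$ be the initial data, $u(0,\cdot)=u^1$, $u_t(0,\cdot)=u^2$. The Kirchhoff–Huygens formula is $u(t,x_0)=\int\rho\,[G\,u^2+u^1G_t]\,dx$, where $G$ is the Green's function. Its time derivative is $u_t(t,x_0)=\int\rho\,[G_t\,u^2+u^1G_{tt}]\,dx$, and the wave equation for $G$, $\rho G_{tt}=\nabla\cdot(\nu\nabla G)$, turns the last term into $\int\rho\,u^1G_{tt}\,dx=\int G\,\nabla\cdot(\nu\nabla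 u^1)\,dx$. Replacing $G$ by $G_0$ defines, for $0<t<\bar T$, $$U(t)=\int G_0(t,x)\,\rho u^2\,dx+\partial_t\!\int G_0(t,x)\,\rho u^1\,dx,$$ $$V(t)=\partial_t\!\int G_0(t,x)\,\rho u^2\,dx+\int G_0(t,x)\,\nabla\cdot(\nu\nabla u^1)\,dx,$$ which are the approximations of $u(t,x_0)$ and $u_t(t,x_0)$ given by the Hadamard–Kirchhoff–Huygens (HKH) propagator. **Claim.** For every $t\in(0,\bar T)$ the generalized integrals and the time derivatives in $U(t)$ and $V(t)$ exist, the integrals below converge absolutely, and the following formulas hold. *If $m=2$*, with $\omega=(\cos\theta,\sin\theta)$ and all functions of $x$ under the integrals evaluated at $x=x(\tau,\omega)$, $$U(t)=u^1(x_0)+\frac1{(-\frac12)!}\int_0^{2\pi}\!\!\int_0^t\frac{1}{\sqrt{t^2-\tau^2}}\,\frac{\tau\,u^2}{4\rho_0c_0^2\pi v_0}\,d\tau\,d\theta+\frac t{(-\frac12)!}\int_0^{2\pi}\!\!\int_0^t\frac{1}{\sqrt{t^2-\tau^2}}\,c^2\nabla\tau\cdot\nabla\Big[\frac{u^1}{4\rho_0c_0^2\pi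 v_0}\Big]d\tau\,d\theta,$$ $$V(t)=u^2(x_0)+\frac1{(-\frac12)!}\int_0^{2\pi}\!\!\int_0^t\frac{1}{\sqrt{t^2-\tau^2}}\,\frac{\tau\,\nabla\cdot(\nu\nabla u^1)}{4\rho_0\rho c_0^2\pi v_0}\,d\tau\,d\theta+\frac t{(-\frac12)!}\int_0^{2\pi}\!\!\int_0^t\frac{1}{\sqrt{t^2-\tau^2}}\,c^2\nabla\tau\cdot\nabla\Big[\frac{u^2}{4\rho_0c_0^2\pi v_0}\Big]d\tau\,d\theta.$$ *If $m=3$*, with $d\omega$ the surface measure of the unit sphere $\mathbb S^2$ and all functions of $x$ under the integrals evaluated at $x=x(t,\omega)$, $$U(t)=\int_{\mathbb S^2}\Big\{t\,\frac{u^2}{8\rho_0c_0^3\pi^2v_0}+\frac{u^1}{8\rho_0c_0^3\pi^2v_0}+t\,c^2\nabla\tau\cdot\nabla\Big(\frac{u^1}{8\rho_0c_0^3\pi^2v_0}\Big)\Big\}\,d\omega,$$ $$V(t)=\int_{\mathbb S^2}\Big\{t\,\frac{\nabla\cdot(\nu\nabla u^1)}{8\rho_0\rho c_0^3\pi^2v_0}+\frac{u^2}{8\rho_0c_0^3\pi^2v_0}+t\,c^2\nabla\tau\cdot\nabla\Big(\frac{u^2}{8\rho_0c_0^3\pi^2v_0}\Big)\Big\}\,d\omega.$$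 -/

import Mathlib

open MeasureTheory Set Metric Filter Topology
open scoped ContDiff

noncomputable section

/-- `m`-dimensional Euclidean space. -/
abbrev Space (m : ℕ) : Type := EuclideanSpace ℝ (Fin m)

/-- Divergence of a vector field, `∑ᵢ ∂ᵢ Fᵢ`. -/
def divergence {m : ℕ} (F : Space m → Space m) (x : Space m) : ℝ :=
  ∑ i, (fderiv ℝ F x (EuclideanSpace.single i 1)) i

/-- The operator `φ ↦ ∇·(ν ∇φ)`. -/
def divGrad {m : ℕ} (ν φ : Space m → ℝ) : Space m → ℝ :=
  divergence (fun x => ν x • gradient φ x)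

/-- Wave speed `c = √(ν / ρ)`. -/
def speed {m : ℕ} (ρ ν : Space m → ℝ) (x : Space m) : ℝ := √(ν x / ρ x)

/-! ### Traveltime and rays -/

/-- The set of travel times, at speed `c`, along the `C¹` paths from `x₀` to `x`. -/
def pathTimes {m : ℕ} (c : Space m → ℝ) (x₀ x : Space m) : Set ℝ :=
  {L | ∃ γ : ℝ → Space m, ContDiff ℝ 1 γ ∧ γ 0 = x₀ ∧ γ 1 = x ∧
    L = ∫ s in (0 : ℝ)..1, ‖deriv γ s‖ / c (γ s)}

/-- The phase function `τ(x₀; x)`: least travel time at speed `c` from `x₀` to `x`. -/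
def travelTime {m : ℕ} (c : Space m → ℝ) (x₀ x : Space m) : ℝ := sInf (pathTimes c x₀ x)

/-- `(x, p)` solves on `[0, T)` the ray equations of the Hamiltonian `H(x, p) = c(x) |p|`,
`x' = c(x) p / |p|`, `p' = -|p| ∇c(x)`, with `x(0) = x₀` and `p(0) = e / c(x₀)`. -/
structure IsRay {m : ℕ} (c : Space m → ℝ) (x₀ e : Space m) (T : ℝ)
    (x p : ℝ → Space m) : Prop where
  x_zero : x 0 = x₀
  p_zero : p 0 = (1 / c x₀) • e
  x_eq : ∀ s ∈ Ico 0 T, HasDerivWithinAt x ((c (x s) / ‖p s‖) • p s) (Ico 0 T) s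
  p_eq : ∀ s ∈ Ico 0 T, HasDerivWithinAt p (-(‖p s‖ • gradient c (x s))) (Ico 0 T) s

/-- There is no caustic (other than `x₀`) before time `T`, and `X` gives the geodesic polar
coordinates `x(τ, e) = X (τ e)`: for each unit vector `e` the curve `τ ↦ X (τ e)` is the ray from
`x₀` with take-off direction `e`, on `[0, T)`; the point `x(τ, e)` is a smooth function of `τ e`,
with invertible derivative; and only one ray reaches each point. -/
structure CausticFree {m : ℕ} (c : Space m → ℝ) (x₀ : Space m) (T : ℝ)
    (X : Space m → Space m) : Prop where
  rays : ∀ e : Space m, ‖e‖ = 1 → ∃ p : ℝ → Space m, IsRay c x₀ e T (fun s => X (s • e)) p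
  smooth : ContDiffOn ℝ ∞ X (ball 0 T)
  nondegenerate : ∀ y ∈ ball (0 : Space m) T, (fderiv ℝ X y).det ≠ 0
  injective : InjOn X (ball 0 T)

/-- `v₀` is the leading Hadamard coefficient on `{τ < T}`: it solves the transport equation
`4 ν τ ∇τ·∇v₀ + [∇·(ν ∇τ²) - 2 m ρ] v₀ = 0` with
`v₀(x₀) = 1 / (2 ρ(x₀) c(x₀)^m π^((m-1)/2))`. -/
structure IsLeadingCoeff {m : ℕ} (ρ ν : Space m → ℝ) (x₀ : Space m) (T : ℝ)
    (v₀ : Space m → ℝ) : Prop where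
  regular : ContDiffOn ℝ 1 v₀ {x | travelTime (speed ρ ν) x₀ x < T}
  transport : ∀ x, travelTime (speed ρ ν) x₀ x < T →
    4 * ν x * travelTime (speed ρ ν) x₀ x *
        inner ℝ (gradient (travelTime (speed ρ ν) x₀) x) (gradient v₀ x)
      + (divGrad ν (fun y => travelTime (speed ρ ν) x₀ y ^ 2) x - 2 * (m : ℝ) * ρ x) * v₀ x = 0
  source : v₀ x₀ = 1 / (2 * ρ x₀ * speed ρ ν x₀ ^ m * Real.pi ^ (((m : ℝ) - 1) / 2))

/-! ### Gelfand-Shilov functions -/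

/-- `λ! = Γ(λ + 1)`. -/
def realFactorial (l : ℝ) : ℝ := Real.Gamma (l + 1)

/-- The function `f₊^λ(ς) = ς₊^λ / λ!`, for `λ > -1`. -/
def gsFun (l ς : ℝ) : ℝ := if ς < 0 then 0 else ς ^ l / realFactorial l

/-- The least `k : ℕ` with `λ + k > -1`. -/
def gsOrder (l : ℝ) : ℕ := ⌊-l⌋₊

/-- For `k = gsOrder λ`, the function `s ↦ ∫ f₊^(λ+k)[s - τ(x)²] ψ(x) dx`. -/
def gsPrimitive {m : ℕ} (l : ℝ) (τ ψ : Space m → ℝ) (s : ℝ) : ℝ :=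
  ∫ x, gsFun (l + gsOrder l) (s - τ x ^ 2) * ψ x

/-- The generalized integral `∫ f₊^λ[s - τ(x)²] ψ(x) dx`, for all real `λ`, with
`f₊^λ = (d/dς)^k f₊^(λ+k)`. -/
def gsIntegral {m : ℕ} (l : ℝ) (τ ψ : Space m → ℝ) (s : ℝ) : ℝ :=
  iteratedDeriv (gsOrder l) (gsPrimitive l τ ψ) s

/-- The generalized integral `gsIntegral λ τ ψ s` is meaningful: the integrals of which it is a
derivative converge, and they can be differentiated as often as needed. -/
def GSRegular {m : ℕ} (l : ℝ) (τ ψ : Space m → ℝ) (s : ℝ) : Prop :=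
  (∀ᶠ r in 𝓝 s, Integrable (fun x => gsFun (l + gsOrder l) (r - τ x ^ 2) * ψ x)) ∧
    ContDiffAt ℝ (gsOrder l) (gsPrimitive l τ ψ) s

/-- The exponent `-(m-1)/2` of the leading Hadamard term. -/
def leadingExponent (m : ℕ) : ℝ := -((m : ℝ) - 1) / 2

/-- The leading Hadamard term `G₀(t, x₀; x) = v₀(x) f₊^(-(m-1)/2)[t² - τ(x)²]`, applied at time
`t` to a function `φ` of `x`. -/
def leadingTerm {m : ℕ} (τ v₀ : Space m → ℝ) (t : ℝ) (φ : Space m → ℝ) : ℝ :=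
  gsIntegral (leadingExponent m) τ (fun x => v₀ x * φ x) (t ^ 2)

/-- `leadingTerm τ v₀ t φ` is meaningful. -/
def LeadingTermRegular {m : ℕ} (τ v₀ : Space m → ℝ) (t : ℝ) (φ : Space m → ℝ) : Prop :=
  GSRegular (leadingExponent m) τ (fun x => v₀ x * φ x) (t ^ 2)

/-! ### Kirchhoff-Huygens formulas
A time-dependent generalized function of `x` is given by its action `G t φ = ∫ G(t, x) φ(x) dx`. -/

/-- `∫ ρ [G(t) u² + u¹ G_t(t)] dx`. -/
def khValue {m : ℕ} (ρ : Space m → ℝ) (G : ℝ → (Space m → ℝ) → ℝ) (u₁ u₂ : Space m → ℝ)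
    (t : ℝ) : ℝ :=
  G t (fun x => ρ x * u₂ x) + deriv (fun r => G r (fun x => ρ x * u₁ x)) t

/-- The second time derivative of `G` as the wave equation gives it, `ρ⁻¹ ∇·(ν ∇G)`, in the sense
of generalized functions. -/
def waveSecond {m : ℕ} (ρ ν : Space m → ℝ) (G : ℝ → (Space m → ℝ) → ℝ) (t : ℝ)
    (φ : Space m → ℝ) : ℝ :=
  G t (divGrad ν (fun x => φ x / ρ x))

/-- `∫ ρ [G_t(t) u² + u¹ G_tt(t)] dx`, with `G_tt` expressed by the wave equation. -/
def khVelocity {m : ℕ} (ρ ν : Space m → ℝ) (G : ℝ → (Space m → ℝ) → ℝ) (u₁ u₂ : Space m → ℝ)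
    (t : ℝ) : ℝ :=
  deriv (fun r => G r (fun x => ρ x * u₂ x)) t + waveSecond ρ ν G t (fun x => ρ x * u₁ x)

/-- `ρ G_tt = ∇·(ν ∇G)` for `t > 0`, in the sense of generalized functions of `x`. -/
def SolvesWaveEq {m : ℕ} (ρ ν : Space m → ℝ) (G : ℝ → (Space m → ℝ) → ℝ) : Prop :=
  ∀ φ : Space m → ℝ, ContDiff ℝ ∞ φ → HasCompactSupport φ → ∀ t : ℝ, 0 < t →
    DifferentiableAt ℝ (fun r => G r (fun x => ρ x * φ x)) t ∧
    HasDerivAt (deriv fun r => G r (fun x => ρ x * φ x)) (G t (divGrad ν φ)) t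

/-- For every solution `G` of the wave equation, hence for the exact Green's function, `khVelocity`
is the time derivative of `khValue`. -/
theorem hasDerivAt_khValue {m : ℕ} {ρ ν : Space m → ℝ} (hρ : ∀ x, 0 < ρ x)
    {G : ℝ → (Space m → ℝ) → ℝ} (hG : SolvesWaveEq ρ ν G) {u₁ u₂ : Space m → ℝ}
    (h₁ : ContDiff ℝ ∞ u₁) (k₁ : HasCompactSupport u₁)
    (h₂ : ContDiff ℝ ∞ u₂) (k₂ : HasCompactSupport u₂) {t : ℝ} (ht : 0 < t) :
    HasDerivAt (khValue ρ G u₁ u₂) (khVelocity ρ ν G u₁ u₂ t) t := by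
  have e : (fun x => ρ x * u₁ x / ρ x) = u₁ := by
    funext x
    exact mul_div_cancel_left₀ _ (hρ x).ne'
  have h := (hG u₂ h₂ k₂ t ht).1.hasDerivAt.add (hG u₁ h₁ k₁ t ht).2
  simp only [khVelocity, waveSecond, e]
  exact h

/-! ### Integrands in geodesic polar coordinates -/

/-- The derivative along rays, `c² ∇τ·∇f`. -/
def rayDeriv {m : ℕ} (ρ ν : Space m → ℝ) (x₀ : Space m) (f : Space m → ℝ) (x : Space m) : ℝ :=
  speed ρ ν x ^ 2 * inner ℝ (gradient (travelTime (speed ρ ν) x₀) x) (gradient f x)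

/-- The unit vector `(cos θ, sin θ)`. -/
def direction (θ : ℝ) : Space 2 := !₂[Real.cos θ, Real.sin θ]

/-- Integration over `0 < τ < t`, `0 < θ < 2π` against the Abel kernel `[t² - τ²]^(-1/2)`. -/
def abelIntegral (t : ℝ) (F : ℝ → ℝ → ℝ) : ℝ :=
  ∫ θ in (0 : ℝ)..(2 * Real.pi), ∫ τ in (0 : ℝ)..t, (t ^ 2 - τ ^ 2) ^ (-(1 / 2) : ℝ) * F τ θ

/-- The double integral `abelIntegral t F` converges absolutely. -/
def AbelIntegrable (t : ℝ) (F : ℝ → ℝ → ℝ) : Prop :=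
  IntegrableOn (fun q : ℝ × ℝ => (t ^ 2 - q.1 ^ 2) ^ (-(1 / 2) : ℝ) * F q.1 q.2)
    (Ioo 0 t ×ˢ Ioo 0 (2 * Real.pi))

/-- Surface measure `dω` on the unit sphere of `ℝ³`. -/
def sphereMeasure : Measure (sphere (0 : Space 3) 1) := (volume : Measure (Space 3)).toSphere

end

/-! The map X provides normal coordinates y = τω around x₀, in which the problem becomes calculus on
a ball. The Gauss lemma `CausticFree.inner_fderiv_self` shows that a path in the image of X raises
|y| at a rate of at most |γ'|/c, with equality along rays. Hence the travel time of X y is |y|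
(`CausticFree.travelTime_apply`), it is at least T off the image of the ball, and c²∇τ·∇ is
differentiation along the rays.

By `CausticFree.divGrad_sq_travelTime`, ∇·(ν∇τ²) equals 2ρ times the sum of m and the derivative of
log(ρ det DX) in the direction y. The term 2mρ of the transport equation cancels the m, and what
remains says that ρ v₀² det DX is constant along rays (`IsLeadingCoeff.mul_sq_mul_det`). The source
condition fixes this constant E = `energyConst`. Therefore v₀ dx = E/(ρ v₀) dy, and pairing G₀ with
φ means integrating the kernel in t² - |y|² against H = Eφ/(ρ v₀), taken at X y
(`IsLeadingCoeff.integral_eq`).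

For m = 3 the kernel is a delta function, the derivative of a Heaviside function: differentiating an
integral over the ball of radius √s gives t/2 times the integral of H over directions, and the
product rule in t finishes. For m = 2 the kernel is an integrable Abel kernel. The dilation r = tz
freezes its singularity, so that only H is differentiated in t; an integration by parts along each
ray (`integral_abelKernel_by_parts`) then leaves the boundary term 2πH(0), which the source
condition turns into u(x₀).

The formula for V is the formula for U with (u², ρ⁻¹∇·(ν∇u¹)) in place of (u¹, u²), so one statement
per dimension serves both. -/

noncomputable section

/-! ### Rays and the Gauss lemma -/

section Rays

variable {m : ℕ} {c : Space m → ℝ} {x₀ : Space m} {T : ℝ} {X : Space m → Space m}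

/-- Conservation of the Hamiltonian c|p|, which equals 1 at the source. The square is differentiated
instead, since it is smooth even where p might vanish. -/
theorem IsRay.speed_mul_norm {e : Space m} {x p : ℝ → Space m} (hc : ContDiff ℝ 1 c)
    (hpos : ∀ x, 0 < c x) (he : ‖e‖ = 1) (h : IsRay c x₀ e T x p) {s : ℝ} (hs : s ∈ Ico 0 T) :
    c (x s) * ‖p s‖ = 1 := by
  have hgrad : ∀ z, HasFDerivAt c (innerSL ℝ (gradient c z)) z := fun z =>
    ((hc.differentiable one_ne_zero) z).hasGradientAt.hasFDerivAt
  have hd : ∀ r ∈ Ico 0 T,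
      HasDerivWithinAt (fun r => c (x r) ^ 2 * inner ℝ (p r) (p r)) 0 (Ico 0 T) r := by
    intro r hr
    have h1 := ((hgrad (x r)).comp_hasDerivWithinAt r (h.x_eq r hr)).pow 2
    have h2 := (h.p_eq r hr).inner ℝ (h.p_eq r hr)
    refine (h1.mul h2).congr_deriv ?_
    -- That p never vanishes is only a consequence of the conservation law, so p = 0 is treated
    -- apart; every term then vanishes.
    rcases eq_or_ne (p r) 0 with h0 | h0
    · simp [h0]
    · have := norm_ne_zero_iff.2 h0
      simp only [Pi.pow_apply, Function.comp, innerSL_apply_apply, inner_smul_right,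
        inner_smul_left,
        inner_neg_left, inner_neg_right, real_inner_self_eq_norm_sq, conj_trivial,
        real_inner_comm (p r) (gradient c (x r)), Nat.cast_ofNat, Nat.add_one_sub_one, pow_one]
      field_simp
      ring
  have h0 : (0 : ℝ) ∈ Ico 0 T := ⟨le_rfl, hs.1.trans_lt hs.2⟩
  have hconst := (convex_Ico (0 : ℝ) T).norm_image_sub_le_of_norm_hasDerivWithin_le (C := 0)
    hd (by simp) h0 hs
  rw [zero_mul, norm_le_zero_iff, sub_eq_zero, h.x_zero, h.p_zero, real_inner_self_eq_norm_sq,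
    real_inner_self_eq_norm_sq, norm_smul, he, Real.norm_eq_abs, mul_one, sq_abs, one_div, inv_pow,
    mul_inv_cancel₀ (pow_pos (hpos x₀) 2).ne', ← mul_pow] at hconst
  exact (pow_eq_one_iff_of_nonneg (mul_nonneg (hpos _).le (norm_nonneg _)) two_ne_zero).1 hconst

theorem CausticFree.contDiffAt (hX : CausticFree c x₀ T X) {y : Space m} (hy : ‖y‖ < T) :
    ContDiffAt ℝ ∞ X y :=
  hX.smooth.contDiffAt (isOpen_ball.mem_nhds (by simpa using hy))

theorem CausticFree.hasFDerivAt (hX : CausticFree c x₀ T X) {y : Space m} (hy : ‖y‖ < T) :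
    HasFDerivAt X (fderiv ℝ X y) y :=
  ((hX.contDiffAt hy).differentiableAt (by simp)).hasFDerivAt

theorem CausticFree.hasFDerivAt_fderiv (hX : CausticFree c x₀ T X) {y : Space m} (hy : ‖y‖ < T) :
    HasFDerivAt (fderiv ℝ X) (fderiv ℝ (fderiv ℝ X) y) y :=
  (((hX.contDiffAt hy).fderiv_right (m := 1)
    (WithTop.coe_le_coe.2 le_top)).differentiableAt one_ne_zero).hasFDerivAt

theorem CausticFree.fderiv_fderiv_comm (hX : CausticFree c x₀ T X) {y : Space m} (hy : ‖y‖ < T)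
    (v w : Space m) : fderiv ℝ (fderiv ℝ X) y v w = fderiv ℝ (fderiv ℝ X) y w v :=
  (hX.contDiffAt hy).isSymmSndFDerivAt
    (by simpa using WithTop.coe_le_coe.2 (le_top (a := (2 : ℕ∞)))) v w

theorem norm_smul_lt_of_mem {e : Space m} (he : ‖e‖ = 1) {s : ℝ} (hs : s ∈ Ico 0 T) :
    ‖s • e‖ < T := by
  rw [norm_smul, he, mul_one, Real.norm_of_nonneg hs.1]; exact hs.2

theorem hasDerivAt_smul_const (e : Space m) (s : ℝ) : HasDerivAt (fun s : ℝ => s • e) e s := by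
  simpa using (hasDerivAt_id s).smul_const e

/-- With |p| = 1/c the ray equations lose their norms: x' = c²p and p' = -∇c/c, where x' is also the
radial derivative of X. -/
theorem CausticFree.exists_covector (hc : ContDiff ℝ 1 c) (hpos : ∀ x, 0 < c x)
    (hX : CausticFree c x₀ T X) {e : Space m} (he : ‖e‖ = 1) :
    ∃ p : ℝ → Space m, ∀ s ∈ Ico 0 T,
      HasDerivWithinAt p (-((c (X (s • e)))⁻¹ • gradient c (X (s • e)))) (Ico 0 T) s ∧
      fderiv ℝ X (s • e) e = c (X (s • e)) ^ 2 • p s ∧ c (X (s • e)) * ‖p s‖ = 1 ∧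
      p 0 = (1 / c x₀) • e ∧ X 0 = x₀ := by
  obtain ⟨p, hp⟩ := hX.rays e he
  refine ⟨p, fun s hs => ?_⟩
  have hE := hp.speed_mul_norm hc hpos he hs
  have hcs := (hpos (X (s • e))).ne'
  have hn : ‖p s‖ = (c (X (s • e)))⁻¹ := eq_inv_of_mul_eq_one_right hE
  refine ⟨?_, ?_, hE, hp.p_zero, by simpa using hp.x_zero⟩
  · rw [← hn]; exact hp.p_eq s hs
  · have h1 := ((hX.hasFDerivAt (norm_smul_lt_of_mem he hs)).comp_hasDerivAt s
      (hasDerivAt_smul_const e s)).hasDerivWithinAt (s := Ico 0 T)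
    have h2 := hp.x_eq s hs
    have := (uniqueDiffOn_Ico (0 : ℝ) T s hs).eq_deriv _ h1 h2
    rw [this, hn, div_inv_eq_mul, sq]

theorem CausticFree.apply_zero [NeZero m] (hX : CausticFree c x₀ T X) : X 0 = x₀ := by
  obtain ⟨p, hp⟩ := hX.rays (EuclideanSpace.single 0 1) (by simp)
  simpa using hp.x_zero

theorem CausticFree.fderiv_zero (hc : ContDiff ℝ 1 c) (hpos : ∀ x, 0 < c x)
    (hX : CausticFree c x₀ T X) (hT : 0 < T) (w : Space m) : fderiv ℝ X 0 w = c x₀ • w := by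
  rcases eq_or_ne w 0 with rfl | hw
  · simp
  have hw' := norm_ne_zero_iff.2 hw
  obtain ⟨p, hp⟩ := hX.exists_covector hc hpos (norm_smul_inv_norm (𝕜 := ℝ) hw)
  obtain ⟨-, h1, -, h2, h3⟩ := hp 0 ⟨le_rfl, hT⟩
  have h0 := (hpos x₀).ne'
  rw [zero_smul, h2, h3, map_smul, smul_smul, smul_smul] at h1
  have h4 := congrArg (fun z => ‖w‖ • z) h1
  simp only [smul_smul, RCLike.ofReal_real_eq_id, id_eq] at h4
  rw [mul_inv_cancel₀ hw', one_smul] at h4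
  rw [h4]; congr 1; field_simp

theorem CausticFree.norm_fderiv_self (hc : ContDiff ℝ 1 c) (hpos : ∀ x, 0 < c x)
    (hX : CausticFree c x₀ T X) {y : Space m} (hy : ‖y‖ < T) :
    ‖fderiv ℝ X y y‖ = c (X y) * ‖y‖ := by
  rcases eq_or_ne y 0 with rfl | h0
  · simp
  have hy' := norm_ne_zero_iff.2 h0
  obtain ⟨p, hp⟩ := hX.exists_covector hc hpos (norm_smul_inv_norm (𝕜 := ℝ) h0)
  obtain ⟨-, h1, h2, -⟩ := hp ‖y‖ ⟨norm_nonneg _, hy⟩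
  simp only [smul_smul, RCLike.ofReal_real_eq_id, id_eq, mul_inv_cancel₀ hy', one_smul] at h1 h2
  have : fderiv ℝ X y y = ‖y‖ • fderiv ℝ X y (‖y‖⁻¹ • y) := by
    rw [← map_smul, smul_smul, mul_inv_cancel₀ hy', one_smul]
  rw [this, h1, norm_smul, norm_smul, norm_norm, Real.norm_of_nonneg (sq_nonneg _), sq, mul_assoc,
    h2, mul_one, mul_comm]

/-- This is the derivative in the direction w of the eikonal identity |DX_z z|² = c(X z)²|z|²,
combined with the symmetry of the second derivative of X. -/
theorem CausticFree.inner_fderiv_second (hc : ContDiff ℝ 1 c) (hpos : ∀ x, 0 < c x)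
    (hX : CausticFree c x₀ T X) {y : Space m} (hy : ‖y‖ < T) (w : Space m) :
    inner ℝ (fderiv ℝ X y y) (fderiv ℝ (fderiv ℝ X) y y w + fderiv ℝ X y w) =
      c (X y) * fderiv ℝ c (X y) (fderiv ℝ X y w) * ‖y‖ ^ 2
        + c (X y) ^ 2 * inner ℝ y w := by
  have hgrad := ((hc.differentiable one_ne_zero) (X y)).hasFDerivAt
  have h1 : HasFDerivAt (fun z => fderiv ℝ X z z) _ y :=
    (hX.hasFDerivAt_fderiv hy).clm_apply (hasFDerivAt_id y)
  have h2 := h1.inner ℝ h1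
  have h3 := ((hgrad.comp y (hX.hasFDerivAt hy)).pow 2).mul
    ((hasFDerivAt_id y).inner ℝ (hasFDerivAt_id y))
  have heq : (fun z => inner ℝ (fderiv ℝ X z z) (fderiv ℝ X z z)) =ᶠ[𝓝 y]
      (fun z => ((c ∘ X) z) ^ 2 * inner ℝ (id z) (id z)) := by
    filter_upwards [isOpen_ball.mem_nhds (show y ∈ ball (0 : Space m) T by simpa using hy)]
      with z hz
    rw [real_inner_self_eq_norm_sq, hX.norm_fderiv_self hc hpos (by simpa using hz),
      real_inner_self_eq_norm_sq, mul_pow]; rfl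
  have h4 := congrArg (fun L => L w) (h2.unique (h3.congr_of_eventuallyEq heq))
  simp [fderivInnerCLM_apply, hX.fderiv_fderiv_comm hy w y] at h4
  simp only [real_inner_comm (fderiv ℝ X y y), real_inner_comm y w] at h4 ⊢
  simp only [inner_add_right] at h4 ⊢
  linarith

end Rays

section GaussLemma

variable {m : ℕ} {c : Space m → ℝ} {x₀ : Space m} {T : ℝ} {X : Space m → Space m}

/-- The field s DX(se)w is the variation of the ray when its initial direction is perturbed by w.
Its product with p, minus s⟨e, w⟩, has zero derivative by the equation for p' and
`CausticFree.inner_fderiv_second`, and it vanishes at s = 0. -/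
theorem CausticFree.inner_covector (hc : ContDiff ℝ 1 c) (hpos : ∀ x, 0 < c x)
    (hX : CausticFree c x₀ T X) {e : Space m} (he : ‖e‖ = 1) {p : ℝ → Space m}
    (hp : ∀ s ∈ Ico 0 T,
      HasDerivWithinAt p (-((c (X (s • e)))⁻¹ • gradient c (X (s • e)))) (Ico 0 T) s)
    (hpX : ∀ s ∈ Ico 0 T, fderiv ℝ X (s • e) e = c (X (s • e)) ^ 2 • p s) (h0 : X 0 = x₀)
    (w : Space m) {s : ℝ} (hs : s ∈ Ico 0 T) :
    inner ℝ (p s) (s • fderiv ℝ X (s • e) w) = s * inner ℝ e w := by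
  have hT : 0 < T := hs.1.trans_lt hs.2
  have hd : ∀ r ∈ Ico 0 T, HasDerivWithinAt
      (fun r => inner ℝ (p r) (r • fderiv ℝ X (r • e) w) - r * inner ℝ e w) 0 (Ico 0 T) r := by
    intro r hr
    have hy := norm_smul_lt_of_mem he hr
    have hcr := (hpos (X (r • e))).ne'
    have h1' : HasDerivAt (fun r : ℝ => fderiv ℝ X (r • e)) (fderiv ℝ (fderiv ℝ X) (r • e) e) r :=
      (hX.hasFDerivAt_fderiv hy).comp_hasDerivAt r (hasDerivAt_smul_const e r)
    have h1 : HasDerivAt (fun r : ℝ => fderiv ℝ X (r • e) w)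
        (fderiv ℝ (fderiv ℝ X) (r • e) e w) r :=
      (ContinuousLinearMap.apply ℝ (Space m) w).hasFDerivAt.comp_hasDerivAt r h1'
    have h2 := ((hp r hr).inner ℝ ((hasDerivAt_id r).smul h1).hasDerivWithinAt).sub
      ((hasDerivAt_id r).mul_const (inner ℝ e w)).hasDerivWithinAt
    refine h2.congr_deriv ?_
    have key : inner ℝ (fderiv ℝ X (r • e) e)
        (r • fderiv ℝ (fderiv ℝ X) (r • e) e w + fderiv ℝ X (r • e) w) =
        c (X (r • e)) * fderiv ℝ c (X (r • e)) (fderiv ℝ X (r • e) w) * r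
          + c (X (r • e)) ^ 2 * inner ℝ e w := by
      -- At y = re the differentiated eikonal identity carries a factor r to be cancelled, so r = 0
      -- is computed from the derivative of X at the origin.
      rcases hr.1.eq_or_lt with h | h
      · subst h
        simp only [zero_smul, zero_add, mul_zero, h0]
        rw [hX.fderiv_zero hc hpos hT, hX.fderiv_zero hc hpos hT, inner_smul_left, inner_smul_right]
        simp; ring
      · have := hX.inner_fderiv_second hc hpos hy w
        simp only [map_smul, smul_apply, norm_smul, he, mul_one,
          Real.norm_eq_abs, sq_abs, inner_smul_left, conj_trivial] at this
        refine mul_left_cancel₀ h.ne' (this.trans ?_)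
        ring
    rw [hpX r hr, inner_smul_left, conj_trivial] at key
    simp only [inner_add_right, inner_smul_right] at key
    simp [inner_smul_left, inner_smul_right, inner_add_right]
    field_simp at key ⊢
    linarith
  have hconst := (convex_Ico (0 : ℝ) T).norm_image_sub_le_of_norm_hasDerivWithin_le (C := 0)
    hd (by simp) (⟨le_rfl, hT⟩ : (0 : ℝ) ∈ Ico 0 T) hs
  simp only [zero_smul, inner_zero_right, zero_mul, sub_zero, norm_le_zero_iff] at hconst
  linarith

/-- The Gauss lemma: the rays from `x₀` are orthogonal to the wave fronts. -/
theorem CausticFree.inner_fderiv_self (hc : ContDiff ℝ 1 c) (hpos : ∀ x, 0 < c x)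
    (hX : CausticFree c x₀ T X) {y : Space m} (hy : ‖y‖ < T) (w : Space m) :
    inner ℝ (fderiv ℝ X y y) (fderiv ℝ X y w) = c (X y) ^ 2 * inner ℝ y w := by
  rcases eq_or_ne y 0 with rfl | h0
  · simp
  have hy' := norm_ne_zero_iff.2 h0
  have he := norm_smul_inv_norm (𝕜 := ℝ) h0
  obtain ⟨p, hp⟩ := hX.exists_covector hc hpos he
  have hs : ‖y‖ ∈ Ico 0 T := ⟨norm_nonneg _, hy⟩
  have h1 := hX.inner_covector hc hpos he (fun s hs => (hp s hs).1) (fun s hs => (hp s hs).2.1)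
    (hp _ hs).2.2.2.2 w hs
  have h2 := (hp _ hs).2.1
  simp only [smul_smul, RCLike.ofReal_real_eq_id, id_eq, mul_inv_cancel₀ hy', one_smul] at h1 h2
  have : fderiv ℝ X y y = ‖y‖ • fderiv ℝ X y (‖y‖⁻¹ • y) := by
    rw [← map_smul, smul_smul, mul_inv_cancel₀ hy', one_smul]
  rw [this, h2]
  simp only [inner_smul_left, inner_smul_right, conj_trivial] at h1 ⊢
  rw [show ‖y‖ * (c (X y) ^ 2 * inner ℝ (p ‖y‖) (fderiv ℝ X y w)) =
    c (X y) ^ 2 * (‖y‖ * inner ℝ (p ‖y‖) (fderiv ℝ X y w)) by ring, h1]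
  field_simp

/-- Cauchy–Schwarz applied to the Gauss lemma: moving by DX w changes the radius |y| by at most |DX
w|/c to first order. -/
theorem CausticFree.speed_mul_abs_inner_le (hc : ContDiff ℝ 1 c) (hpos : ∀ x, 0 < c x)
    (hX : CausticFree c x₀ T X) {y : Space m} (hy : ‖y‖ < T) (w : Space m) :
    c (X y) * inner ℝ y w ≤ ‖y‖ * ‖fderiv ℝ X y w‖ := by
  have h := real_inner_le_norm (fderiv ℝ X y y) (fderiv ℝ X y w)
  rw [hX.inner_fderiv_self hc hpos hy, hX.norm_fderiv_self hc hpos hy] at h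
  exact le_of_mul_le_mul_left (by linarith) (hpos (X y))

end GaussLemma

/-! ### Geodesic normal coordinates -/

section NormalCoordinates

variable {m : ℕ} {c : Space m → ℝ} {x₀ : Space m} {T : ℝ} {X : Space m → Space m}

/-- The derivative of `X` as a linear equivalence. -/
def CausticFree.fderivEquiv (hX : CausticFree c x₀ T X) {y : Space m} (hy : ‖y‖ < T) :
    Space m ≃L[ℝ] Space m :=
  (fderiv ℝ X y).toContinuousLinearEquivOfDetNeZero (hX.nondegenerate y (by simpa using hy))

@[simp] theorem CausticFree.coe_fderivEquiv (hX : CausticFree c x₀ T X) {y : Space m}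
    (hy : ‖y‖ < T) : (hX.fderivEquiv hy : Space m →L[ℝ] Space m) = fderiv ℝ X y :=
  ContinuousLinearMap.coe_toContinuousLinearEquivOfDetNeZero _ _

@[simp] theorem CausticFree.fderivEquiv_apply (hX : CausticFree c x₀ T X) {y : Space m}
    (hy : ‖y‖ < T) (w : Space m) : hX.fderivEquiv hy w = fderiv ℝ X y w := rfl

theorem CausticFree.hasStrictFDerivAt (hX : CausticFree c x₀ T X) {y : Space m} (hy : ‖y‖ < T) :
    HasStrictFDerivAt X (hX.fderivEquiv hy : Space m →L[ℝ] Space m) y := by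
  rw [hX.coe_fderivEquiv]
  exact (hX.contDiffAt hy).hasStrictFDerivAt (by simp)

/-- The inverse of `X`. -/
def normalCoord (X : Space m → Space m) (T : ℝ) : Space m → Space m :=
  Function.invFunOn X (ball 0 T)

theorem CausticFree.normalCoord_apply (hX : CausticFree c x₀ T X) {y : Space m} (hy : ‖y‖ < T) :
    normalCoord X T (X y) = y :=
  hX.injective.leftInvOn_invFunOn (by simpa using hy)

theorem CausticFree.isOpen_image_ball (hX : CausticFree c x₀ T X) {r : ℝ} (hr : r ≤ T) :
    IsOpen (X '' ball 0 r) := by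
  rw [isOpen_iff_mem_nhds]
  rintro _ ⟨y, hy, rfl⟩
  have hy' : ‖y‖ < r := by simpa using hy
  rw [← (hX.hasStrictFDerivAt (hy'.trans_le hr)).map_nhds_eq_of_equiv]
  exact image_mem_map (isOpen_ball.mem_nhds hy)

/-- Injectivity of X forces the global inverse to agree near X y with the smooth local inverse of
the inverse function theorem. -/
theorem CausticFree.contDiffAt_normalCoord (hX : CausticFree c x₀ T X) {y : Space m}
    (hy : ‖y‖ < T) : ContDiffAt ℝ ∞ (normalCoord X T) (X y) := by
  have hf := hX.contDiffAt hy
  have hf' : HasFDerivAt X (hX.fderivEquiv hy : Space m →L[ℝ] Space m) y :=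
    (hX.hasStrictFDerivAt hy).hasFDerivAt
  refine (hf.to_localInverse hf' (by simp)).congr_of_eventuallyEq ?_
  have hs := hX.hasStrictFDerivAt hy
  have h1 := hs.eventually_right_inverse
  have h2 : Tendsto (hs.localInverse X _ y) (𝓝 (X y)) (𝓝 y) := hs.localInverse_tendsto
  filter_upwards [h1, h2.eventually (isOpen_ball.mem_nhds (show y ∈ ball 0 T by simpa using hy))]
    with z hz1 hz2
  have := hX.normalCoord_apply (y := hs.localInverse X _ y z) (by simpa using hz2)
  rw [hz1] at this
  exact this

theorem CausticFree.fderiv_normalCoord (hX : CausticFree c x₀ T X) {y : Space m}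
    (hy : ‖y‖ < T) (w : Space m) :
    fderiv ℝ (normalCoord X T) (X y) (fderiv ℝ X y w) = w := by
  have h1 := (((hX.contDiffAt_normalCoord hy).differentiableAt (by simp)).hasFDerivAt).comp y
    (hX.hasFDerivAt hy)
  have h2 : normalCoord X T ∘ X =ᶠ[𝓝 y] id := by
    filter_upwards [isOpen_ball.mem_nhds (show y ∈ ball 0 T by simpa using hy)] with z hz
    exact hX.normalCoord_apply (by simpa using hz)
  exact congrArg (fun L => L w) (h1.unique ((hasFDerivAt_id y).congr_of_eventuallyEq h2))

end NormalCoordinates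

/-! ### The travel time in normal coordinates -/

section TravelTime

variable {m : ℕ} {c : Space m → ℝ} {x₀ : Space m} {T : ℝ} {X : Space m → Space m}

theorem pathTimes_nonneg (hpos : ∀ x, 0 < c x) {x : Space m} {L : ℝ} (hL : L ∈ pathTimes c x₀ x) :
    0 ≤ L := by
  obtain ⟨γ, -, -, -, rfl⟩ := hL
  exact intervalIntegral.integral_nonneg zero_le_one
    fun s _ => div_nonneg (norm_nonneg _) (hpos _).le

theorem pathTimes_bddBelow (hpos : ∀ x, 0 < c x) (x : Space m) : BddBelow (pathTimes c x₀ x) :=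
  ⟨0, fun _ => pathTimes_nonneg hpos⟩

theorem pathTimes_nonempty (x : Space m) : (pathTimes c x₀ x).Nonempty :=
  ⟨_, fun s => x₀ + s • (x - x₀), by fun_prop, by simp, by simp, rfl⟩

theorem continuous_pathTimes_integrand (hc : Continuous c) (hpos : ∀ x, 0 < c x)
    {γ : ℝ → Space m} (hγ : ContDiff ℝ 1 γ) : Continuous fun s => ‖deriv γ s‖ / c (γ s) :=
  (hγ.continuous_deriv le_rfl).norm.div (hc.comp hγ.continuous) fun _ => (hpos _).ne'

/-- A path that stays in the normal chart up to time b has needed at least its final radius as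
travel time: integrate the radial speed bound `CausticFree.speed_mul_abs_inner_le`. -/
theorem CausticFree.norm_le_integral (hc : ContDiff ℝ 1 c) (hpos : ∀ x, 0 < c x)
    (hX : CausticFree c x₀ T X) (hX0 : X 0 = x₀) (hT : 0 < T) {γ : ℝ → Space m}
    (hγ : ContDiff ℝ 1 γ)
    (h0 : γ 0 = x₀) {b : ℝ} (hb : 0 ≤ b) (hγX : ∀ s ∈ Icc 0 b, γ s ∈ X '' ball 0 T) :
    ‖normalCoord X T (γ b)‖ ≤ ∫ s in (0 : ℝ)..b, ‖deriv γ s‖ / c (γ s) := by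
  set q : ℝ → Space m := fun s => normalCoord X T (γ s) with hq
  have hcont := continuous_pathTimes_integrand hc.continuous hpos hγ
  have hqd : ∀ s ∈ Icc 0 b, ‖q s‖ < T ∧ X (q s) = γ s ∧ ∃ q', HasDerivAt q q' s ∧
      fderiv ℝ X (q s) q' = deriv γ s := by
    intro s hs
    obtain ⟨y, hy, hys⟩ := hγX s hs
    have hy' : ‖y‖ < T := by simpa using hy
    have hqs : q s = y := by simp only [hq]; rw [← hys, hX.normalCoord_apply hy']
    have hd : HasDerivAt γ (deriv γ s) s := (hγ.differentiable one_ne_zero s).hasDerivAt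
    have h1 : HasFDerivAt (normalCoord X T) (fderiv ℝ (normalCoord X T) (γ s)) (γ s) := by
      rw [← hys]
      exact ((hX.contDiffAt_normalCoord hy').differentiableAt (by simp)).hasFDerivAt
    refine ⟨hqs ▸ hy', hqs ▸ hys, _, h1.comp_hasDerivAt s hd, ?_⟩
    obtain ⟨w, hw⟩ := (hX.fderivEquiv hy').surjective (deriv γ s)
    rw [hX.fderivEquiv_apply] at hw
    rw [hqs, ← hw, ← hys, hX.fderiv_normalCoord hy']
  have hq0 : q 0 = 0 := by
    simp only [hq]; rw [h0, ← hX0, hX.normalCoord_apply (by simpa using hT)]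
  -- The radius |q| is not differentiable where q = 0. It is replaced by √(ε² + |q|²), which obeys
  -- the same bound and starts at ε.
  refine le_of_forall_pos_le_add fun ε hε => ?_
  have hpos' : ∀ s, 0 < ε ^ 2 + ‖q s‖ ^ 2 := fun s => by positivity
  choose! q' hq' using fun s hs => (hqd s hs).2.2
  have hder : ∀ s ∈ Icc 0 b, HasDerivAt (fun s => √(ε ^ 2 + ‖q s‖ ^ 2))
      (inner ℝ (q s) (q' s) / √(ε ^ 2 + ‖q s‖ ^ 2)) s := by
    intro s hs
    refine (((hq' s hs).1.norm_sq.const_add (ε ^ 2)).sqrt (hpos' s).ne').congr_deriv ?_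
    field_simp
  have hle := intervalIntegral.sub_le_integral_of_hasDeriv_right_of_le hb
    (fun s hs => (hder s hs).continuousAt.continuousWithinAt)
    (fun s hs => (hder s (Ioo_subset_Icc_self hs)).hasDerivWithinAt)
    (φ := fun s => ‖deriv γ s‖ / c (γ s)) hcont.continuousOn.integrableOn_Icc (by
      intro s hs
      have hs' := Ioo_subset_Icc_self hs
      obtain ⟨h1, h2, -⟩ := hqd s hs'
      have h3 := hX.speed_mul_abs_inner_le hc hpos h1 (q' s)
      rw [h2, (hq' s hs').2] at h3
      have h4 : ‖q s‖ ≤ √(ε ^ 2 + ‖q s‖ ^ 2) := Real.le_sqrt_of_sq_le (by nlinarith [sq_nonneg ε])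
      rw [div_le_div_iff₀ (Real.sqrt_pos.2 (hpos' s)) (hpos _), mul_comm]
      exact h3.trans ((mul_le_mul_of_nonneg_right h4 (norm_nonneg _)).trans_eq (mul_comm _ _)))
  have h5 : ‖q b‖ ≤ √(ε ^ 2 + ‖q b‖ ^ 2) := Real.le_sqrt_of_sq_le (by nlinarith [sq_nonneg ε])
  rw [hq0, norm_zero, zero_pow two_ne_zero, add_zero, Real.sqrt_sq hε.le] at hle
  linarith

/-- Either the path leaves the image of the ball of radius r, and reaching its boundary already
costs time r, or it stays inside and `CausticFree.norm_le_integral` applies up to its endpoint. -/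
theorem CausticFree.path_dichotomy (hc : ContDiff ℝ 1 c) (hpos : ∀ x, 0 < c x)
    (hX : CausticFree c x₀ T X) (hX0 : X 0 = x₀) {γ : ℝ → Space m} (hγ : ContDiff ℝ 1 γ)
    (h0 : γ 0 = x₀) {r : ℝ} (hr0 : 0 < r) (hr : r < T) :
    r ≤ (∫ s in (0 : ℝ)..1, ‖deriv γ s‖ / c (γ s)) ∨
      ∃ y, ‖y‖ < r ∧ X y = γ 1 ∧ ‖y‖ ≤ ∫ s in (0 : ℝ)..1, ‖deriv γ s‖ / c (γ s) := by
  have hT := hr0.trans hr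
  have hcont := continuous_pathTimes_integrand hc.continuous hpos hγ
  set S : Set ℝ := Icc 0 1 ∩ γ ⁻¹' (X '' ball 0 r)ᶜ with hS
  have hSc : IsClosed S :=
    isClosed_Icc.inter ((hX.isOpen_image_ball hr.le).isClosed_compl.preimage hγ.continuous)
  have hsub : ball (0 : Space m) r ⊆ ball 0 T := ball_subset_ball hr.le
  rcases S.eq_empty_or_nonempty with hE | hne
  · right
    have hin : ∀ s ∈ Icc (0 : ℝ) 1, γ s ∈ X '' ball 0 r := by
      intro s hs
      by_contra h
      exact (hE ▸ (⟨hs, h⟩ : s ∈ S) : s ∈ (∅ : Set ℝ))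
    obtain ⟨y, hy, hy1⟩ := hin 1 ⟨zero_le_one, le_rfl⟩
    have h := hX.norm_le_integral hc hpos hX0 hT hγ h0 zero_le_one
      fun s hs => image_mono hsub (hin s hs)
    rw [← hy1, hX.normalCoord_apply (by simpa using hsub hy)] at h
    exact ⟨y, by simpa using hy, hy1, h⟩
  · left
    have hbdd : BddBelow S := ⟨0, fun s hs => hs.1.1⟩
    obtain ⟨hb1, hb2⟩ := hSc.csInf_mem hne hbdd
    -- This is the first exit time. Since r < T, the closed ball of radius r has a compact, hence
    -- closed, image, so γ(b) has a radius ‖y‖ ≤ r; the exit excludes ‖y‖ < r.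
    set b := sInf S with hb
    have hin : ∀ s ∈ Ico 0 b, γ s ∈ X '' ball 0 r := by
      intro s hs
      by_contra h
      exact absurd (csInf_le hbdd (⟨⟨hs.1, hs.2.le.trans hb1.2⟩, h⟩ : s ∈ S)) (not_le.2 hs.2)
    have hK : IsCompact (X '' closedBall 0 r) :=
      (isCompact_closedBall _ _).image_of_continuousOn
        (hX.smooth.continuousOn.mono (closedBall_subset_ball hr))
    have hb0 : 0 < b := by
      refine hb1.1.lt_of_ne fun h => hb2 ?_
      rw [← h, h0, ← hX0]
      exact mem_image_of_mem _ (by simpa using hr0)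
    have hin' : ∀ s ∈ Icc 0 b, γ s ∈ X '' closedBall 0 r := by
      have : closure (Ico 0 b) ⊆ γ ⁻¹' (X '' closedBall 0 r) :=
        closure_minimal (fun s hs => image_mono ball_subset_closedBall (hin s hs))
          (hK.isClosed.preimage hγ.continuous)
      rwa [closure_Ico hb0.ne] at this
    obtain ⟨y, hy, hyb⟩ := hin' b ⟨hb0.le, le_rfl⟩
    have hyr : ‖y‖ = r := by
      refine le_antisymm (by simpa using hy) (not_lt.1 fun h => hb2 ?_)
      exact ⟨y, by simpa using h, hyb⟩
    have h := hX.norm_le_integral hc hpos hX0 hT hγ h0 hb0.le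
      fun s hs => image_mono (closedBall_subset_ball hr) (hin' s hs)
    rw [← hyb, hX.normalCoord_apply (hyr ▸ hr), hyr] at h
    refine h.trans (intervalIntegral.integral_mono_interval le_rfl hb0.le hb1.2 ?_ ?_)
    · exact Eventually.of_forall fun s => div_nonneg (norm_nonneg _) (hpos _).le
    · exact hcont.intervalIntegrable _ _

theorem CausticFree.norm_mem_pathTimes (hc : ContDiff ℝ 1 c) (hpos : ∀ x, 0 < c x)
    (hX : CausticFree c x₀ T X) (hX0 : X 0 = x₀) {y : Space m} (hy : ‖y‖ < T) :
    ‖y‖ ∈ pathTimes c x₀ (X y) := by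
  -- The competing path must be C¹ on all of ℝ, while the ray is known only for times below T. This
  -- reparametrization stays in [0, 1] for every s, goes from 0 to 1 on the unit interval and is
  -- monotone there, so the travel time is unchanged.
  set χ : ℝ → ℝ := fun s => (1 - Real.cos (Real.pi * s)) / 2 with hχ
  have hχ0 : ∀ s, 0 ≤ χ s := fun s => by
    have := Real.cos_le_one (Real.pi * s); simp only [hχ]; linarith
  have hχ1 : ∀ s, χ s ≤ 1 := fun s => by
    have := Real.neg_one_le_cos (Real.pi * s); simp only [hχ]; linarith
  have hχc : ContDiff ℝ 1 χ := by fun_prop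
  have hχd : ∀ s, HasDerivAt χ (Real.pi / 2 * Real.sin (Real.pi * s)) s := by
    intro s
    refine ((((hasDerivAt_id s).const_mul Real.pi).cos.const_sub 1).div_const 2).congr_deriv ?_
    simp; ring
  have hn : ∀ s, ‖χ s • y‖ < T := fun s => by
    rw [norm_smul, Real.norm_of_nonneg (hχ0 s)]
    exact (mul_le_of_le_one_left (norm_nonneg _) (hχ1 s)).trans_lt hy
  have hγ : ContDiff ℝ 1 fun s => X (χ s • y) := by
    rw [contDiff_iff_contDiffAt]
    intro s
    exact ((hX.contDiffAt (hn s)).of_le (by simp)).comp s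
      (hχc.smul contDiff_const).contDiffAt
  have hspeed : ∀ s, ‖fderiv ℝ X (χ s • y) y‖ = c (X (χ s • y)) * ‖y‖ := by
    intro s
    rcases (hχ0 s).eq_or_lt with h | h
    · rw [← h, zero_smul, hX.fderiv_zero hc hpos ((norm_nonneg y).trans_lt hy), norm_smul, hX0,
        Real.norm_of_nonneg (hpos _).le]
    · have := hX.norm_fderiv_self hc hpos (hn s)
      rw [map_smul, norm_smul, norm_smul, Real.norm_of_nonneg h.le] at this
      exact mul_left_cancel₀ h.ne' (this.trans (by ring))
  refine ⟨fun s => X (χ s • y), hγ, by simp [hχ, hX0], by simp [hχ], ?_⟩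
  have hint : ∀ s ∈ uIcc (0 : ℝ) 1, ‖deriv (fun s => X (χ s • y)) s‖ / c (X (χ s • y)) =
      Real.pi / 2 * Real.sin (Real.pi * s) * ‖y‖ := by
    intro s hs
    rw [uIcc_of_le zero_le_one] at hs
    have h1 := (hX.hasFDerivAt (hn s)).comp_hasDerivAt s ((hχd s).smul_const y)
    have h2 : 0 ≤ Real.pi / 2 * Real.sin (Real.pi * s) :=
      mul_nonneg (by positivity) (Real.sin_nonneg_of_nonneg_of_le_pi
        (mul_nonneg Real.pi_pos.le hs.1) (mul_le_of_le_one_right Real.pi_pos.le hs.2))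
    have h3 : deriv (fun s => X (χ s • y)) s = _ := h1.deriv
    rw [h3, map_smul, norm_smul, Real.norm_of_nonneg h2, hspeed]
    have := (hpos (X (χ s • y))).ne'
    field_simp
  rw [intervalIntegral.integral_congr hint, intervalIntegral.integral_mul_const,
    intervalIntegral.integral_eq_sub_of_hasDerivAt (fun s _ => hχd s)
      (Continuous.intervalIntegrable (by fun_prop) _ _)]
  simp [hχ]

theorem CausticFree.travelTime_apply (hc : ContDiff ℝ 1 c) (hpos : ∀ x, 0 < c x)
    (hX : CausticFree c x₀ T X) (hX0 : X 0 = x₀) {y : Space m} (hy : ‖y‖ < T) :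
    travelTime c x₀ (X y) = ‖y‖ := by
  refine le_antisymm
    (csInf_le (pathTimes_bddBelow hpos _) (hX.norm_mem_pathTimes hc hpos hX0 hy)) ?_
  refine le_csInf (pathTimes_nonempty _) ?_
  rintro _ ⟨γ, hγ, h0, h1, rfl⟩
  obtain ⟨r, hr1, hr2⟩ := exists_between hy
  rcases hX.path_dichotomy hc hpos hX0 hγ h0 ((norm_nonneg y).trans_lt hr1) hr2 with h | h
  · exact hr1.le.trans h
  · obtain ⟨z, hz, hz1, hz2⟩ := h
    rw [h1] at hz1
    rwa [hX.injective (by simpa using hz.trans hr2) (by simpa using hy) hz1] at hz2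

/-- A path to a point outside the chart exits the image of each ball of radius r < T, so it takes at
least time r. -/
theorem CausticFree.le_travelTime (hc : ContDiff ℝ 1 c) (hpos : ∀ x, 0 < c x)
    (hX : CausticFree c x₀ T X) (hX0 : X 0 = x₀) (hT : 0 < T) {x : Space m}
    (hx : x ∉ X '' ball 0 T) : T ≤ travelTime c x₀ x := by
  refine le_csInf (pathTimes_nonempty _) ?_
  rintro _ ⟨γ, hγ, h0, h1, rfl⟩
  refine le_of_forall_lt fun r hr => ?_
  obtain ⟨r', hr1, hr2⟩ := exists_between (max_lt hr hT)
  rcases hX.path_dichotomy hc hpos hX0 hγ h0 ((le_max_right _ _).trans_lt hr1) hr2 with h | h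
  · exact ((le_max_left _ _).trans_lt hr1).trans_le h
  · obtain ⟨z, hz, hz1, -⟩ := h
    exact absurd ⟨z, by simpa using hz.trans hr2, hz1.trans h1⟩ hx

theorem CausticFree.travelTime_lt_iff (hc : ContDiff ℝ 1 c) (hpos : ∀ x, 0 < c x)
    (hX : CausticFree c x₀ T X) (hX0 : X 0 = x₀) (hT : 0 < T) {x : Space m} :
    travelTime c x₀ x < T ↔ x ∈ X '' ball 0 T := by
  refine ⟨fun h => by_contra fun hx => absurd (hX.le_travelTime hc hpos hX0 hT hx) (not_le.2 h), ?_⟩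
  rintro ⟨y, hy, rfl⟩
  have hy' : ‖y‖ < T := by simpa using hy
  rwa [hX.travelTime_apply hc hpos hX0 hy']

end TravelTime

/-! ### The derivative of the determinant -/

section Determinant

variable {m : ℕ}

/-- The trace of a continuous linear endomorphism. -/
def opTrace (A : Space m →L[ℝ] Space m) : ℝ := LinearMap.trace ℝ (Space m) A

theorem opTrace_add (A B : Space m →L[ℝ] Space m) : opTrace (A + B) = opTrace A + opTrace B := by
  simp [opTrace]

theorem opTrace_smul (r : ℝ) (A : Space m →L[ℝ] Space m) : opTrace (r • A) = r * opTrace A := by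
  simp [opTrace]

theorem opTrace_id : opTrace (ContinuousLinearMap.id ℝ (Space m)) = m := by
  simp [opTrace]

theorem opTrace_smulRight (φ : Space m →L[ℝ] ℝ) (v : Space m) : opTrace (φ.smulRight v) = φ v :=
  LinearMap.trace_smulRight (φ : Space m →ₗ[ℝ] ℝ) v

theorem opTrace_conj (e : Space m ≃L[ℝ] Space m) (A : Space m →L[ℝ] Space m) :
    opTrace ((e : Space m →L[ℝ] Space m) ∘L A ∘L (e.symm : Space m →L[ℝ] Space m)) = opTrace A :=
  LinearMap.trace_conj' (A : Space m →ₗ[ℝ] Space m) e.toLinearEquiv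

theorem differentiable_clm_det :
    Differentiable ℝ fun A : Space m →L[ℝ] Space m => A.det := by
  have h : (fun A : Space m →L[ℝ] Space m => A.det) = fun A =>
      ∑ σ : Equiv.Perm (Fin m), ((Equiv.Perm.sign σ : ℤ) : ℝ) *
        ∏ i, (A (EuclideanSpace.single i 1)) (σ i) := by
    funext A
    rw [ContinuousLinearMap.det,
      ← LinearMap.det_toMatrix (EuclideanSpace.basisFun (Fin m) ℝ).toBasis, Matrix.det_apply']
    simp [LinearMap.toMatrix_apply]
  rw [h]
  fun_prop

/-- Jacobi's formula. It follows from the factorization det(A + tA') = det A · det(1 + tA⁻¹A') and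
from the trace being the linear coefficient of det(1 + tM). -/
theorem hasDerivAt_clm_det {A : ℝ → Space m →L[ℝ] Space m} {A' : Space m →L[ℝ] Space m} {s : ℝ}
    (hA : HasDerivAt A A' s) (B : Space m ≃L[ℝ] Space m) (hB : (B : Space m →L[ℝ] Space m) = A s) :
    HasDerivAt (fun r => (A r).det)
      ((A s).det * opTrace ((B.symm : Space m →L[ℝ] Space m) ∘L A')) s := by
  set L : Space m →L[ℝ] Space m := (B.symm : Space m →L[ℝ] Space m) ∘L A' with hL
  have h1 := (differentiable_clm_det (A s)).hasFDerivAt.comp_hasDerivAt s hA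
  refine h1.congr_deriv ?_
  have h2 : HasDerivAt (fun t : ℝ => A s + t • A') A' 0 := by
    simpa using ((hasDerivAt_id (0 : ℝ)).smul_const A').const_add (A s)
  have h3 := (differentiable_clm_det (A s)).hasFDerivAt
  rw [← add_zero (A s), ← zero_smul ℝ A'] at h3
  have h3' := h3.comp_hasDerivAt (0 : ℝ) h2
  simp only [zero_smul, add_zero] at h3'
  -- The differential of det at A s, applied to A', is the derivative at 0 along the line A s + tA',
  -- where it can be computed.
  refine h3'.unique ?_
  set M := LinearMap.toMatrix (EuclideanSpace.basisFun (Fin m) ℝ).toBasis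
    (EuclideanSpace.basisFun (Fin m) ℝ).toBasis (L : Space m →ₗ[ℝ] Space m) with hM
  have h4 : ((fun A : Space m →L[ℝ] Space m => A.det) ∘ fun t : ℝ => A s + t • A') =
      fun t => (A s).det * (1 + t • M).det := by
    funext t
    have h5 : A s + t • A' = A s ∘L (ContinuousLinearMap.id ℝ _ + t • L) := by
      ext1 v
      simp [hL, ← hB]
    simp only [Function.comp, h5]
    have h6 : (1 + t • M) = LinearMap.toMatrix (EuclideanSpace.basisFun (Fin m) ℝ).toBasis
        (EuclideanSpace.basisFun (Fin m) ℝ).toBasis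
        ((ContinuousLinearMap.id ℝ _ + t • L : Space m →L[ℝ] Space m) :
          Space m →ₗ[ℝ] Space m) := by
      simp only [hM, ContinuousLinearMap.toLinearMap_add, ContinuousLinearMap.toLinearMap_smul,
        map_add, map_smul]
      congr 1
      exact (LinearMap.toMatrix_id _).symm
    rw [h6, LinearMap.det_toMatrix, ContinuousLinearMap.det, ContinuousLinearMap.det]
    exact LinearMap.det_comp _ _
  rw [h4]
  refine HasDerivAt.const_mul _ ?_
  rw [opTrace, LinearMap.trace_eq_matrix_trace ℝ (EuclideanSpace.basisFun (Fin m) ℝ).toBasis, ← hM]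
  set Q := (Matrix.det (1 + (Polynomial.X : Polynomial ℝ) • M.map Polynomial.C)) with hQ
  have h7 : (fun t : ℝ => (1 + t • M).det) = fun t => Q.eval t := by
    funext t
    rw [hQ, ← Polynomial.coe_evalRingHom, RingHom.map_det]
    congr 1
    ext i j
    simp [Matrix.one_apply, apply_ite, mul_comm t]
  rw [h7, ← Matrix.derivative_det_one_add_X_smul]
  exact Q.hasDerivAt 0

theorem divergence_eq_trace (F : Space m → Space m) (x : Space m) :
    divergence F x = opTrace (fderiv ℝ F x) := by
  rw [opTrace, LinearMap.trace_eq_sum_inner _ (EuclideanSpace.basisFun (Fin m) ℝ)]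
  simp [divergence, PiLp.inner_apply]

end Determinant

/-! ### Derivatives of the travel time -/

section TravelTimeDeriv

variable {m : ℕ} {c : Space m → ℝ} {x₀ : Space m} {T : ℝ} {X : Space m → Space m}

theorem CausticFree.travelTime_eventuallyEq (hc : ContDiff ℝ 1 c) (hpos : ∀ x, 0 < c x)
    (hX : CausticFree c x₀ T X) (hX0 : X 0 = x₀) {y : Space m} (hy : ‖y‖ < T) :
    travelTime c x₀ =ᶠ[𝓝 (X y)] fun x => ‖normalCoord X T x‖ := by
  filter_upwards [(hX.isOpen_image_ball le_rfl).mem_nhds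
    (mem_image_of_mem X (show y ∈ ball 0 T by simpa using hy))]
  rintro _ ⟨z, hz, rfl⟩
  have hz' : ‖z‖ < T := by simpa using hz
  rw [hX.travelTime_apply hc hpos hX0 hz', hX.normalCoord_apply hz']

/-- Near X y, τ² is the squared norm of the normal coordinate, whose derivative along DX w is 2⟨y,
w⟩; the Gauss lemma rewrites this as (2/c²)⟨DX y, DX w⟩. The squared form also covers the source. -/
theorem CausticFree.gradient_sq_travelTime (hc : ContDiff ℝ 1 c) (hpos : ∀ x, 0 < c x)
    (hX : CausticFree c x₀ T X) (hX0 : X 0 = x₀) {y : Space m} (hy : ‖y‖ < T) :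
    gradient (fun x => travelTime c x₀ x ^ 2) (X y) = (2 / c (X y) ^ 2) • fderiv ℝ X y y := by
  have h1 := (((hX.contDiffAt_normalCoord hy).differentiableAt (by simp)).hasFDerivAt).norm_sq
  have h2 : HasFDerivAt (fun x => travelTime c x₀ x ^ 2) _ (X y) :=
    h1.congr_of_eventuallyEq ((hX.travelTime_eventuallyEq hc hpos hX0 hy).fun_comp (· ^ 2))
  refine (hasGradientAt_iff_hasFDerivAt.2 (h2.congr_fderiv ?_)).gradient
  ext1 v
  obtain ⟨w, rfl⟩ := (hX.fderivEquiv hy).surjective v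
  have := (hpos (X y)).ne'
  simp only [hX.fderivEquiv_apply, InnerProductSpace.toDual_apply_apply, inner_smul_left,
    hX.inner_fderiv_self hc hpos hy, hX.normalCoord_apply hy, conj_trivial]
  simp [hX.fderiv_normalCoord hy]
  field_simp

theorem CausticFree.gradient_travelTime (hc : ContDiff ℝ 1 c) (hpos : ∀ x, 0 < c x)
    (hX : CausticFree c x₀ T X) (hX0 : X 0 = x₀) {y : Space m} (hy : ‖y‖ < T) (hy0 : y ≠ 0) :
    gradient (travelTime c x₀) (X y) = (1 / (c (X y) ^ 2 * ‖y‖)) • fderiv ℝ X y y := by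
  have hn := norm_ne_zero_iff.2 hy0
  have h0 := ((hX.contDiffAt_normalCoord hy).differentiableAt (by simp)).hasFDerivAt
  have hval := hX.normalCoord_apply hy
  have h1 : HasFDerivAt (fun x => ‖normalCoord X T x‖)
      (fderiv ℝ (fun x => ‖normalCoord X T x‖) (X y)) (X y) :=
    (h0.differentiableAt.norm ℝ (by rw [hval]; exact hy0)).hasFDerivAt
  have h2 := h1.pow 2
  have h3 := h2.unique h0.norm_sq
  have h4 := h1.congr_of_eventuallyEq (hX.travelTime_eventuallyEq hc hpos hX0 hy)
  refine (hasGradientAt_iff_hasFDerivAt.2 (h4.congr_fderiv ?_)).gradient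
  ext1 v
  obtain ⟨w, rfl⟩ := (hX.fderivEquiv hy).surjective v
  have := (hpos (X y)).ne'
  have h5 := congrArg (fun L => L (fderiv ℝ X y w)) h3
  simp [hval, hX.fderiv_normalCoord hy] at h5
  simp only [hX.fderivEquiv_apply, InnerProductSpace.toDual_apply_apply, inner_smul_left,
    hX.inner_fderiv_self hc hpos hy, conj_trivial]
  field_simp
  linarith

end TravelTimeDeriv

/-! ### Wave speed and differentiation along rays -/

section Medium

variable {m : ℕ} {ρ ν : Space m → ℝ}

theorem speed_pos (hρ : ∀ x, 0 < ρ x) (hν : ∀ x, 0 < ν x) (x : Space m) : 0 < speed ρ ν x :=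
  Real.sqrt_pos.2 (div_pos (hν x) (hρ x))

theorem mul_speed_sq (hρ : ∀ x, 0 < ρ x) (hν : ∀ x, 0 < ν x) (x : Space m) :
    ρ x * speed ρ ν x ^ 2 = ν x := by
  rw [speed, Real.sq_sqrt (div_pos (hν x) (hρ x)).le, mul_div_cancel₀ _ (hρ x).ne']

theorem contDiff_speed {n : WithTop ℕ∞} (hρ : ∀ x, 0 < ρ x) (hν : ∀ x, 0 < ν x)
    (hρd : ContDiff ℝ n ρ) (hνd : ContDiff ℝ n ν) : ContDiff ℝ n (speed ρ ν) :=
  (hνd.div hρd fun x => (hρ x).ne').sqrt fun x => (div_pos (hν x) (hρ x)).ne'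

variable {x₀ : Space m} {T : ℝ} {X : Space m → Space m}

/-- The vector c²∇τ is the ray velocity DX(y/|y|), so the operator is ∂/∂τ in polar normal
coordinates. -/
theorem rayDeriv_apply (hρ : ∀ x, 0 < ρ x) (hν : ∀ x, 0 < ν x)
    (hρd : ContDiff ℝ 1 ρ) (hνd : ContDiff ℝ 1 ν) (hX : CausticFree (speed ρ ν) x₀ T X)
    (hX0 : X 0 = x₀) {y : Space m} (hy : ‖y‖ < T) (hy0 : y ≠ 0) {f : Space m → ℝ}
    (hf : DifferentiableAt ℝ f (X y)) :
    rayDeriv ρ ν x₀ f (X y) = ‖y‖⁻¹ * fderiv ℝ (f ∘ X) y y := by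
  have hc := contDiff_speed hρ hν hρd hνd
  have hpos := speed_pos hρ hν
  have := (hpos (X y)).ne'
  rw [rayDeriv, hX.gradient_travelTime hc hpos hX0 hy hy0, inner_smul_left,
    (hf.hasFDerivAt.comp y (hX.hasFDerivAt hy)).fderiv]
  simp only [inner_gradient_right, ContinuousLinearMap.comp_apply, conj_trivial]
  field_simp

end Medium

/-! ### The transport equation -/

section Transport

variable {m : ℕ} {ρ ν : Space m → ℝ} {x₀ : Space m} {T : ℝ} {X : Space m → Space m}

/-- Here ν∇τ² = 2ρ DX(Y)Y with Y the inverse of X. Its divergence is a trace: differentiating ρ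
gives the radial derivative of ρ, differentiating the argument Y gives the identity, whose trace is
m, and differentiating DX gives the logarithmic derivative of det DX. -/
theorem CausticFree.divGrad_sq_travelTime (hρ : ∀ x, 0 < ρ x) (hν : ∀ x, 0 < ν x)
    (hρd : ContDiff ℝ 1 ρ) (hνd : ContDiff ℝ 1 ν) (hX : CausticFree (speed ρ ν) x₀ T X)
    (hX0 : X 0 = x₀) {y : Space m} (hy : ‖y‖ < T) :
    divGrad ν (fun x => travelTime (speed ρ ν) x₀ x ^ 2) (X y) =
      2 * fderiv ℝ (ρ ∘ X) y y + 2 * ρ (X y) * (opTrace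
        (((hX.fderivEquiv hy).symm : Space m →L[ℝ] Space m) ∘L fderiv ℝ (fderiv ℝ X) y y) + m) := by
  have hc := contDiff_speed hρ hν hρd hνd
  have hpos := speed_pos hρ hν
  set Y := normalCoord X T with hY
  have hval : Y (X y) = y := hX.normalCoord_apply hy
  have hY' : HasFDerivAt Y (fderiv ℝ Y (X y)) (X y) :=
    ((hX.contDiffAt_normalCoord hy).differentiableAt (by simp)).hasFDerivAt
  have heq : (fun x => ν x • gradient (fun x => travelTime (speed ρ ν) x₀ x ^ 2) x) =ᶠ[𝓝 (X y)]
      fun x => (2 * ρ x) • fderiv ℝ X (Y x) (Y x) := by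
    filter_upwards [(hX.isOpen_image_ball le_rfl).mem_nhds
      (mem_image_of_mem X (show y ∈ ball 0 T by simpa using hy))]
    rintro _ ⟨z, hz, rfl⟩
    have hz' : ‖z‖ < T := by simpa using hz
    rw [hX.gradient_sq_travelTime hc hpos hX0 hz', hY, hX.normalCoord_apply hz', smul_smul,
      ← mul_speed_sq hρ hν]
    have := (hpos (X z)).ne'
    congr 1
    field_simp
  have hD : HasFDerivAt (fderiv ℝ X) (fderiv ℝ (fderiv ℝ X) (Y (X y))) (Y (X y)) :=
    hX.hasFDerivAt_fderiv (by rw [hval]; exact hy)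
  have h1 : HasFDerivAt (fun x => fderiv ℝ X (Y x) (Y x)) _ (X y) :=
    (hD.comp (X y) hY').clm_apply hY'
  have hρ' : HasFDerivAt ρ (fderiv ℝ ρ (X y)) (X y) :=
    (hρd.differentiable one_ne_zero _).hasFDerivAt
  have h2 : HasFDerivAt (fun x => (2 * ρ x) • fderiv ℝ X (Y x) (Y x)) _ (X y) :=
    (hρ'.const_mul 2).smul h1
  rw [divGrad, divergence_eq_trace, heq.fderiv_eq, h2.fderiv]
  have hsymm : ∀ v, (hX.fderivEquiv hy).symm v = fderiv ℝ Y (X y) v := by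
    intro v
    obtain ⟨w, rfl⟩ := (hX.fderivEquiv hy).surjective v
    rw [ContinuousLinearEquiv.symm_apply_apply, hX.fderivEquiv_apply, hX.fderiv_normalCoord hy]
  set e := (hX.fderivEquiv hy) with he
  -- Writing the derivative as a conjugate by e = DX lets the trace be read off in normal
  -- coordinates.
  have hL : (2 * ρ (X y)) • (fderiv ℝ X (Y (X y)) ∘L fderiv ℝ Y (X y) +
        ((fderiv ℝ (fderiv ℝ X) (Y (X y))).comp (fderiv ℝ Y (X y))).flip (Y (X y))) =
      (2 * ρ (X y)) • ((e : Space m →L[ℝ] Space m) ∘L (ContinuousLinearMap.id ℝ _ +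
        (e.symm : Space m →L[ℝ] Space m) ∘L fderiv ℝ (fderiv ℝ X) y y) ∘L
          (e.symm : Space m →L[ℝ] Space m)) := by
    congr 1
    ext1 v
    obtain ⟨w, rfl⟩ := e.surjective v
    have he2 : e.symm (e w) = w := e.symm_apply_apply w
    simp [hval, ← hsymm, he2, hX.fderiv_fderiv_comm hy _ y]
    rfl
  rw [opTrace_add, Function.comp_apply, hL, opTrace_smul, opTrace_conj, opTrace_add, opTrace_id,
    opTrace_smulRight,
    hval, (hρ'.comp y (hX.hasFDerivAt hy)).fderiv]
  simp
  ring

theorem IsLeadingCoeff.contDiffAt (hρ : ∀ x, 0 < ρ x) (hν : ∀ x, 0 < ν x)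
    (hρd : ContDiff ℝ 1 ρ) (hνd : ContDiff ℝ 1 ν) (hX : CausticFree (speed ρ ν) x₀ T X)
    (hX0 : X 0 = x₀) {v₀ : Space m → ℝ} (hv : IsLeadingCoeff ρ ν x₀ T v₀) {y : Space m}
    (hy : ‖y‖ < T) : ContDiffAt ℝ 1 v₀ (X y) := by
  refine hv.regular.contDiffAt ?_
  filter_upwards [(hX.isOpen_image_ball le_rfl).mem_nhds
    (mem_image_of_mem X (show y ∈ ball 0 T by simpa using hy))] with x hx
  exact (hX.travelTime_lt_iff (contDiff_speed hρ hν hρd hνd) (speed_pos hρ hν) hX0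
    ((norm_nonneg y).trans_lt hy)).2 hx

theorem IsLeadingCoeff.transport_along (hρ : ∀ x, 0 < ρ x) (hν : ∀ x, 0 < ν x)
    (hρd : ContDiff ℝ 1 ρ) (hνd : ContDiff ℝ 1 ν) (hX : CausticFree (speed ρ ν) x₀ T X)
    (hX0 : X 0 = x₀) {v₀ : Space m → ℝ} (hv : IsLeadingCoeff ρ ν x₀ T v₀) {y : Space m}
    (hy : ‖y‖ < T) (hy0 : y ≠ 0) :
    2 * ρ (X y) * fderiv ℝ (v₀ ∘ X) y y + (fderiv ℝ (ρ ∘ X) y y + ρ (X y) * opTrace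
      (((hX.fderivEquiv hy).symm : Space m →L[ℝ] Space m) ∘L fderiv ℝ (fderiv ℝ X) y y)) *
        v₀ (X y) = 0 := by
  have hc := contDiff_speed hρ hν hρd hνd
  have hpos := speed_pos hρ hν
  have hτ := hX.travelTime_apply hc hpos hX0 hy
  have h := hv.transport (X y) (hτ.trans_lt hy)
  have hn := norm_ne_zero_iff.2 hy0
  have hcy := (hpos (X y)).ne'
  have hvd := (hv.contDiffAt hρ hν hρd hνd hX hX0 hy).differentiableAt one_ne_zero
  rw [hX.divGrad_sq_travelTime hρ hν hρd hνd hX0 hy, hX.gradient_travelTime hc hpos hX0 hy hy0, hτ,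
    inner_smul_left, inner_gradient_right, ← mul_speed_sq hρ hν] at h
  rw [(hvd.hasFDerivAt.comp y (hX.hasFDerivAt hy)).fderiv]
  simp only [conj_trivial, ContinuousLinearMap.comp_apply] at h ⊢
  field_simp at h
  linarith

/-- Conservation of energy in ray tubes. -/
theorem IsLeadingCoeff.mul_sq_mul_det (hρ : ∀ x, 0 < ρ x) (hν : ∀ x, 0 < ν x)
    (hρd : ContDiff ℝ 1 ρ) (hνd : ContDiff ℝ 1 ν) (hX : CausticFree (speed ρ ν) x₀ T X)
    (hX0 : X 0 = x₀) {v₀ : Space m → ℝ} (hv : IsLeadingCoeff ρ ν x₀ T v₀) {y : Space m}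
    (hy : ‖y‖ < T) :
    ρ (X y) * v₀ (X y) ^ 2 * (fderiv ℝ X y).det = ρ x₀ * v₀ x₀ ^ 2 * speed ρ ν x₀ ^ m := by
  have hc := contDiff_speed hρ hν hρd hνd
  have hpos := speed_pos hρ hν
  have hT := (norm_nonneg y).trans_lt hy
  have hdet0 : (fderiv ℝ X 0).det = speed ρ ν x₀ ^ m := by
    have : fderiv ℝ X 0 = speed ρ ν x₀ • ContinuousLinearMap.id ℝ (Space m) := by
      ext1 w
      simp [hX.fderiv_zero hc hpos hT]
    rw [this, ContinuousLinearMap.det, ContinuousLinearMap.toLinearMap_smul, LinearMap.det_smul]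
    simp
  rcases eq_or_ne y 0 with rfl | hy0
  · rw [hX0, hdet0]
  have hz : ∀ s ∈ Icc (0 : ℝ) 1, ‖s • y‖ < T := fun s hs => by
    rw [norm_smul, Real.norm_of_nonneg hs.1]
    exact (mul_le_of_le_one_left (norm_nonneg _) hs.2).trans_lt hy
  set f : ℝ → ℝ := fun s => ρ (X (s • y)) * v₀ (X (s • y)) ^ 2 * (fderiv ℝ X (s • y)).det with hf
  -- By Jacobi's formula the derivative of ρ v₀² det DX is v₀ det DX times the left side of the
  -- transport equation along the ray.
  have hd : ∀ s (hs : s ∈ Icc (0 : ℝ) 1), HasDerivAt f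
      (v₀ (X (s • y)) * (fderiv ℝ X (s • y)).det *
      (2 * ρ (X (s • y)) * fderiv ℝ (v₀ ∘ X) (s • y) y + (fderiv ℝ (ρ ∘ X) (s • y) y +
        ρ (X (s • y)) * opTrace (((hX.fderivEquiv (hz s hs)).symm : Space m →L[ℝ] Space m) ∘L
          fderiv ℝ (fderiv ℝ X) (s • y) y)) * v₀ (X (s • y)))) s := by
    intro s hs
    have hline := hasDerivAt_smul_const y s
    have hXd := (hX.hasFDerivAt (hz s hs)).differentiableAt
    have h1 : HasDerivAt ((ρ ∘ X) ∘ fun s : ℝ => s • y) (fderiv ℝ (ρ ∘ X) (s • y) y) s :=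
      ((hρd.differentiable one_ne_zero _).comp (s • y) hXd).hasFDerivAt.comp_hasDerivAt s hline
    have h2 : HasDerivAt ((v₀ ∘ X) ∘ fun s : ℝ => s • y) (fderiv ℝ (v₀ ∘ X) (s • y) y) s :=
      (((hv.contDiffAt hρ hν hρd hνd hX hX0 (hz s hs)).differentiableAt one_ne_zero).comp
        (s • y) hXd).hasFDerivAt.comp_hasDerivAt s hline
    have h3' : HasDerivAt (fun s : ℝ => fderiv ℝ X (s • y)) (fderiv ℝ (fderiv ℝ X) (s • y) y) s :=
      (hX.hasFDerivAt_fderiv (hz s hs)).comp_hasDerivAt s hline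
    have h3 := hasDerivAt_clm_det h3' (hX.fderivEquiv (hz s hs)) (hX.coe_fderivEquiv _)
    refine ((h1.mul (h2.pow 2)).mul h3).congr_deriv ?_
    simp
    ring
  -- The mean value theorem supplies an interior s > 0. There sy ≠ 0, so the transport equation
  -- applies, and the factor s between the directions sy and y cancels.
  obtain ⟨s, hs, hs'⟩ := exists_hasDerivAt_eq_slope f _ zero_lt_one
    (fun s hs => (hd s hs).continuousAt.continuousWithinAt)
    (fun s hs => (hd s (Ioo_subset_Icc_self hs)).differentiableAt.hasDerivAt)
  have hsI := Ioo_subset_Icc_self hs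
  have key := hv.transport_along hρ hν hρd hνd hX hX0 (hz s hsI) (smul_ne_zero hs.1.ne' hy0)
  simp only [map_smul, ContinuousLinearMap.comp_smul, opTrace_smul, smul_eq_mul] at key
  have h0 : deriv f s = 0 := by
    rw [(hd s hsI).deriv]
    refine mul_eq_zero_of_right _ (mul_left_cancel₀ hs.1.ne' ?_)
    rw [mul_zero]
    linarith
  rw [h0] at hs'
  have h1 : f 1 = f 0 := by linarith
  simpa [hf, hX0, hdet0] using h1

end Transport

/-! ### Integrals in normal coordinates -/

section ChangeOfVariables

variable {m : ℕ} {ρ ν : Space m → ℝ} {x₀ : Space m} {T : ℝ} {X : Space m → Space m}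
  {v₀ : Space m → ℝ}

/-- The constant value along rays of the energy density `ρ v₀² det DX`. -/
def energyConst {m : ℕ} (ρ ν : Space m → ℝ) (x₀ : Space m) : ℝ :=
  1 / (4 * ρ x₀ * speed ρ ν x₀ ^ m * Real.pi ^ ((m : ℝ) - 1))

theorem energyConst_pos (hρ : ∀ x, 0 < ρ x) (hν : ∀ x, 0 < ν x) : 0 < energyConst ρ ν x₀ :=
  one_div_pos.2 (mul_pos (mul_pos (mul_pos four_pos (hρ _)) (pow_pos (speed_pos hρ hν _) _))
    (Real.rpow_pos_of_pos Real.pi_pos _))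

theorem IsLeadingCoeff.source_energy (hρ : ∀ x, 0 < ρ x) (hν : ∀ x, 0 < ν x)
    (hv : IsLeadingCoeff ρ ν x₀ T v₀) :
    ρ x₀ * v₀ x₀ ^ 2 * speed ρ ν x₀ ^ m = energyConst ρ ν x₀ := by
  have h1 := (hρ x₀).ne'
  have h2 := (speed_pos hρ hν x₀).ne'
  have h3 : Real.pi ^ (((m : ℝ) - 1) / 2) ≠ 0 := (Real.rpow_pos_of_pos Real.pi_pos _).ne'
  have h4 : Real.pi ^ ((m : ℝ) - 1) = (Real.pi ^ (((m : ℝ) - 1) / 2)) ^ 2 := by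
    rw [← Real.rpow_mul_natCast Real.pi_pos.le]; congr 1; push_cast; ring
  rw [hv.source, energyConst, h4]
  field_simp
  norm_num

/-- The function `φ / (ρ v₀)`, up to a constant, in normal coordinates. -/
def pullback (ρ ν : Space m → ℝ) (x₀ : Space m) (X : Space m → Space m) (v₀ φ : Space m → ℝ)
    (y : Space m) : ℝ := energyConst ρ ν x₀ * (φ (X y) / (ρ (X y) * v₀ (X y)))

theorem CausticFree.integrand_support (hρ : ∀ x, 0 < ρ x) (hν : ∀ x, 0 < ν x)
    (hρd : ContDiff ℝ 1 ρ) (hνd : ContDiff ℝ 1 ν) (hX : CausticFree (speed ρ ν) x₀ T X)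
    (hX0 : X 0 = x₀) {g : ℝ → ℝ} (hg : ∀ ς < 0, g ς = 0) {s : ℝ}
    (hT : 0 < T) (hs : s < T ^ 2) (ψ : Space m → ℝ) (x : Space m) (hx : x ∉ X '' ball 0 T) :
    g (s - travelTime (speed ρ ν) x₀ x ^ 2) * ψ x = 0 := by
  have h := hX.le_travelTime (contDiff_speed hρ hν hρd hνd) (speed_pos hρ hν) hX0 hT hx
  rw [hg, zero_mul]
  nlinarith

variable (hρ : ∀ x, 0 < ρ x) (hν : ∀ x, 0 < ν x) (hρd : ContDiff ℝ 1 ρ) (hνd : ContDiff ℝ 1 ν)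
  (hX : CausticFree (speed ρ ν) x₀ T X) (hX0 : X 0 = x₀) (hv : IsLeadingCoeff ρ ν x₀ T v₀)

include hρ hν hρd hνd hX hX0 hv

theorem IsLeadingCoeff.ne_zero {y : Space m} (hy : ‖y‖ < T) : v₀ (X y) ≠ 0 := by
  intro h
  have h1 := hv.mul_sq_mul_det hρ hν hρd hνd hX hX0 hy
  rw [hv.source_energy hρ hν, h] at h1
  have := energyConst_pos (x₀ := x₀) hρ hν
  simp at h1
  linarith

/-- Since ρ v₀² det DX = E > 0, the determinant is positive and det DX · v₀ = E/(ρ v₀): the Jacobian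
moves v₀ into the denominator, as in the final formulas. -/
theorem IsLeadingCoeff.abs_det_mul {y : Space m} (hy : ‖y‖ < T) (φ : Space m → ℝ) :
    |(fderiv ℝ X y).det| * (v₀ (X y) * φ (X y)) = pullback ρ ν x₀ X v₀ φ y := by
  have h1 := hv.mul_sq_mul_det hρ hν hρd hνd hX hX0 hy
  rw [hv.source_energy hρ hν] at h1
  have hE := energyConst_pos (x₀ := x₀) hρ hν
  have hne := hv.ne_zero hρ hν hρd hνd hX hX0 hy
  have hρ' := hρ (X y)
  have hdet : 0 < (fderiv ℝ X y).det := by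
    have : 0 < ρ (X y) * v₀ (X y) ^ 2 := by positivity
    exact (mul_pos_iff_of_pos_left this).1 (h1 ▸ hE)
  rw [abs_of_pos hdet, pullback, ← h1]
  field_simp

/-- Change of variables x = X y. Nothing is lost outside the chart, because τ ≥ T there makes s - τ²
negative. -/
theorem IsLeadingCoeff.integral_eq {g : ℝ → ℝ} (hg : ∀ ς < 0, g ς = 0) {s : ℝ}
    (hT : 0 < T) (hs : s < T ^ 2) (φ : Space m → ℝ) :
    ∫ x, g (s - travelTime (speed ρ ν) x₀ x ^ 2) * (v₀ x * φ x) =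
      ∫ y in ball 0 T, g (s - ‖y‖ ^ 2) * pullback ρ ν x₀ X v₀ φ y := by
  rw [← setIntegral_eq_integral_of_forall_compl_eq_zero
    (hX.integrand_support hρ hν hρd hνd hX0 hg hT hs fun x => v₀ x * φ x),
    integral_image_eq_integral_abs_det_fderiv_smul volume measurableSet_ball
      (fun y hy => (hX.hasFDerivAt (by simpa using hy)).hasFDerivWithinAt) hX.injective]
  refine setIntegral_congr_fun measurableSet_ball fun y hy => ?_
  have hy' : ‖y‖ < T := by simpa using hy
  rw [← hv.abs_det_mul hρ hν hρd hνd hX hX0 hy',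
    hX.travelTime_apply (contDiff_speed hρ hν hρd hνd) (speed_pos hρ hν) hX0 hy', smul_eq_mul]
  ring

theorem IsLeadingCoeff.integrable_iff {g : ℝ → ℝ} (hg : ∀ ς < 0, g ς = 0) {s : ℝ}
    (hT : 0 < T) (hs : s < T ^ 2) (φ : Space m → ℝ) :
    Integrable (fun x => g (s - travelTime (speed ρ ν) x₀ x ^ 2) * (v₀ x * φ x)) ↔
      IntegrableOn (fun y => g (s - ‖y‖ ^ 2) * pullback ρ ν x₀ X v₀ φ y) (ball 0 T) := by
  rw [← integrableOn_iff_integrable_of_support_subset (s := X '' ball 0 T)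
    (Function.support_subset_iff'.2 (hX.integrand_support hρ hν hρd hνd hX0 hg hT hs
      fun x => v₀ x * φ x)),
    integrableOn_image_iff_integrableOn_abs_det_fderiv_smul volume measurableSet_ball
      (fun y hy => (hX.hasFDerivAt (by simpa using hy)).hasFDerivWithinAt) hX.injective]
  refine integrableOn_congr_fun (fun y hy => ?_) measurableSet_ball
  have hy' : ‖y‖ < T := by simpa using hy
  rw [← hv.abs_det_mul hρ hν hρd hνd hX hX0 hy',
    hX.travelTime_apply (contDiff_speed hρ hν hρd hνd) (speed_pos hρ hν) hX0 hy', smul_eq_mul]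
  ring

theorem IsLeadingCoeff.continuousOn_pullback {φ : Space m → ℝ} (hφ : Continuous φ) :
    ContinuousOn (pullback ρ ν x₀ X v₀ φ) (ball 0 T) := by
  have h1 := hX.smooth.continuousOn
  have h2 : ContinuousOn (fun y => v₀ (X y)) (ball 0 T) := fun y hy =>
    ((hv.contDiffAt hρ hν hρd hνd hX hX0 (by simpa using hy)).continuousAt.comp
      (hX.contDiffAt (by simpa using hy)).continuousAt).continuousWithinAt
  refine continuousOn_const.mul ((hφ.comp_continuousOn h1).div
    ((hρd.continuous.comp_continuousOn h1).mul h2) fun y hy => ?_)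
  exact mul_ne_zero (hρ _).ne' (hv.ne_zero hρ hν hρd hνd hX hX0 (by simpa using hy))

theorem IsLeadingCoeff.contDiffOn_pullback {u : Space m → ℝ} (hu : ContDiff ℝ 1 u) :
    ContDiffOn ℝ 1 (pullback ρ ν x₀ X v₀ fun x => ρ x * u x) (ball 0 T) := by
  intro y hy
  have hy' : ‖y‖ < T := by simpa using hy
  have h1 : ContDiffAt ℝ 1 X y := (hX.contDiffAt hy').of_le (by simp)
  have h2 := (hv.contDiffAt hρ hν hρd hνd hX hX0 hy').comp y h1
  have h3 : ContDiffAt ℝ 1 (fun y => ρ (X y)) y := hρd.contDiffAt.comp y h1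
  have h4 : ContDiffAt ℝ 1 (fun y => u (X y)) y := hu.contDiffAt.comp y h1
  exact (contDiffAt_const.mul ((h3.mul h4).div (h3.mul h2)
    (mul_ne_zero (hρ _).ne' (hv.ne_zero hρ hν hρd hνd hX hX0 hy')))).contDiffWithinAt

/-- The factor ρ of the datum cancels in the pullback, leaving a constant multiple of u/v₀; its ray
derivative is a radial derivative. The free constant k absorbs the different normalizations for m =
2 and m = 3. -/
theorem IsLeadingCoeff.rayDeriv_eq {u : Space m → ℝ} (hu : ContDiff ℝ 1 u) {e : Space m}
    (he : ‖e‖ = 1) {r : ℝ} (hr : 0 < r) (hrT : r < T) {k : ℝ} :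
    rayDeriv ρ ν x₀ (fun x => k * (u x / v₀ x)) (X (r • e)) = k / energyConst ρ ν x₀ *
      fderiv ℝ (pullback ρ ν x₀ X v₀ fun x => ρ x * u x) (r • e) e := by
  have hn : ‖r • e‖ = r := by rw [norm_smul, he, mul_one, Real.norm_of_nonneg hr.le]
  have hy : ‖r • e‖ < T := hn.trans_lt hrT
  have hE := (energyConst_pos (x₀ := x₀) hρ hν).ne'
  have hne := hv.ne_zero hρ hν hρd hνd hX hX0 hy
  have hd : DifferentiableAt ℝ (fun x => u x / v₀ x) (X (r • e)) :=
    (hu.contDiffAt.div (hv.contDiffAt hρ hν hρd hνd hX hX0 hy) hne).differentiableAt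
    one_ne_zero
  have he0 : r • e ≠ 0 := by rw [← norm_ne_zero_iff, hn]; exact hr.ne'
  rw [rayDeriv_apply hρ hν hρd hνd hX hX0 hy he0 (hd.const_mul k), hn, map_smul,
    smul_eq_mul, inv_mul_cancel_left₀ hr.ne']
  have heq : ((fun x => k * (u x / v₀ x)) ∘ X) =ᶠ[𝓝 (r • e)] fun y => k / energyConst ρ ν x₀ *
      pullback ρ ν x₀ X v₀ (fun x => ρ x * u x) y := by
    refine Eventually.of_forall fun y => ?_
    have := (hρ (X y)).ne'
    simp only [Function.comp, pullback]
    rw [mul_div_mul_left _ _ this]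
    field_simp
  have hp : DifferentiableAt ℝ (pullback ρ ν x₀ X v₀ fun x => ρ x * u x) (r • e) :=
    ((hv.contDiffOn_pullback hρ hν hρd hνd hX hX0 hu).contDiffAt
      (isOpen_ball.mem_nhds (by simpa using hy))).differentiableAt one_ne_zero
  rw [heq.fderiv_eq, fderiv_const_mul hp]
  rfl

end ChangeOfVariables

theorem continuous_divGrad {m : ℕ} {ν u : Space m → ℝ} (hν : ContDiff ℝ 1 ν)
    (hu : ContDiff ℝ 2 u) : Continuous (divGrad ν u) := by
  have h1 : ContDiff ℝ 1 (gradient u) :=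
    (InnerProductSpace.toDual ℝ (Space m)).symm.contDiff.comp (hu.fderiv_right (by norm_num))
  have h2 : Continuous (fderiv ℝ fun x => ν x • gradient u x) :=
    (hν.smul h1).continuous_fderiv one_ne_zero
  unfold divGrad divergence
  fun_prop

/-! ### Integrals of dilated functions -/

section Dilation

variable {m : ℕ} {T : ℝ} {H : Space m → ℝ} {α : Type*} [MeasurableSpace α] {μ : Measure α}
  {w : α → ℝ} {d : α → Space m}

theorem norm_smul_lt {r : ℝ} {v : Space m} (hr : |r| < T) (hv : ‖v‖ ≤ 1) : ‖r • v‖ < T := by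
  rw [norm_smul, Real.norm_eq_abs]
  exact (mul_le_of_le_one_right (abs_nonneg _) hv).trans_lt hr

theorem aestronglyMeasurable_dilation (hH : ContinuousOn H (ball 0 T)) (hd : Measurable d)
    (hd1 : ∀ᵐ a ∂μ, ‖d a‖ ≤ 1) {r : ℝ} (hr : |r| < T) :
    AEStronglyMeasurable (fun a => H (r • d a)) μ := by
  classical
  -- H is controlled only on the ball, so measurability is obtained from its extension by zero.
  have h1 : Measurable ((ball (0 : Space m) T).piecewise H 0) :=
    hH.measurable_piecewise continuousOn_const measurableSet_ball
  refine (h1.comp (hd.const_smul r)).aestronglyMeasurable.congr ?_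
  filter_upwards [hd1] with a ha
  simp [norm_smul_lt hr ha]

theorem exists_bound_closedBall {F : Type*} [NormedAddCommGroup F] {H : Space m → F}
    (hH : ContinuousOn H (ball 0 T)) {R : ℝ} (hR : R < T) :
    ∃ C, ∀ y, ‖y‖ ≤ R → ‖H y‖ ≤ C := by
  obtain ⟨C, hC⟩ := (isCompact_closedBall (0 : Space m) R).exists_bound_of_continuousOn
    (hH.mono (closedBall_subset_ball hR))
  exact ⟨C, fun y hy => hC y (by simpa using hy)⟩

theorem integrable_mul_dilation (hH : ContinuousOn H (ball 0 T)) (hw : Integrable w μ)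
    (hd : Measurable d) (hd1 : ∀ᵐ a ∂μ, ‖d a‖ ≤ 1) {r : ℝ} (hr : |r| < T) :
    Integrable (fun a => w a * H (r • d a)) μ := by
  obtain ⟨C, hC⟩ := exists_bound_closedBall hH hr
  refine hw.mul_bdd (c := C) (aestronglyMeasurable_dilation hH hd hd1 hr) ?_
  filter_upwards [hd1] with a ha
  refine hC _ ?_
  rw [norm_smul, Real.norm_eq_abs]
  exact mul_le_of_le_one_right (abs_nonneg _) ha

theorem continuousAt_integral_dilation (hH : ContinuousOn H (ball 0 T)) (hw : Integrable w μ)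
    (hd : Measurable d) (hd1 : ∀ᵐ a ∂μ, ‖d a‖ ≤ 1) {r : ℝ} (hr : |r| < T) :
    ContinuousAt (fun r => ∫ a, w a * H (r • d a) ∂μ) r := by
  obtain ⟨R, hR1, hR2⟩ := exists_between hr
  obtain ⟨C, hC⟩ := exists_bound_closedBall hH hR2
  have hev : ∀ᶠ r' in 𝓝 r, |r'| < R := continuous_abs.continuousAt.eventually_lt_const hR1
  refine continuousAt_of_dominated (bound := fun a => ‖w a‖ * C) ?_ ?_ (hw.norm.mul_const C) ?_
  · filter_upwards [hev] with r' hr'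
    exact (integrable_mul_dilation hH hw hd hd1 (hr'.trans hR2)).aestronglyMeasurable
  · filter_upwards [hev] with r' hr'
    filter_upwards [hd1] with a ha
    rw [norm_mul]
    exact mul_le_mul_of_nonneg_left (hC _ (norm_smul_lt hr' ha).le) (norm_nonneg _)
  · filter_upwards [hd1] with a ha
    have h1 : ContinuousAt H (r • d a) :=
      hH.continuousAt (isOpen_ball.mem_nhds (by simpa using norm_smul_lt hr ha))
    exact continuousAt_const.mul (ContinuousAt.comp (f := fun r : ℝ => r • d a) h1 (by fun_prop))

theorem ContDiffOn.hasFDerivAt_ball (hH : ContDiffOn ℝ 1 H (ball 0 T)) {y : Space m}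
    (hy : ‖y‖ < T) : HasFDerivAt H (fderiv ℝ H y) y :=
  ((hH.contDiffAt (isOpen_ball.mem_nhds (by simpa using hy))).differentiableAt
    one_ne_zero).hasFDerivAt

theorem ContDiffOn.hasDerivAt_dilation (hH : ContDiffOn ℝ 1 H (ball 0 T)) {v : Space m} {r : ℝ}
    (hr : ‖r • v‖ < T) : HasDerivAt (fun r : ℝ => H (r • v)) (fderiv ℝ H (r • v) v) r :=
  (hH.hasFDerivAt_ball hr).comp_hasDerivAt r (hasDerivAt_smul_const v r)

/-- Differentiation under the integral, dominated on |r'| < R < T by |w| times a bound of DH on the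
compact ball of radius R. It serves the sphere with w = 1 and the disc with the Abel weight. -/
theorem hasDerivAt_integral_dilation (hH : ContDiffOn ℝ 1 H (ball 0 T)) (hw : Integrable w μ)
    (hd : Measurable d) (hd1 : ∀ᵐ a ∂μ, ‖d a‖ ≤ 1) {r : ℝ} (hr : |r| < T) :
    Integrable (fun a => w a * fderiv ℝ H (r • d a) (d a)) μ ∧
    HasDerivAt (fun r => ∫ a, w a * H (r • d a) ∂μ)
      (∫ a, w a * fderiv ℝ H (r • d a) (d a) ∂μ) r := by
  obtain ⟨R, hR1, hR2⟩ := exists_between hr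
  obtain ⟨C, hC⟩ := exists_bound_closedBall (hH.continuousOn_fderiv_of_isOpen isOpen_ball le_rfl)
    hR2
  have hev : ∀ᶠ r' in 𝓝 r, |r'| < R := continuous_abs.continuousAt.eventually_lt_const hR1
  refine hasDerivAt_integral_of_dominated_loc_of_deriv_le (bound := fun a => ‖w a‖ * C)
    (F := fun r a => w a * H (r • d a)) (F' := fun r a => w a * fderiv ℝ H (r • d a) (d a))
    hev ?_ (integrable_mul_dilation hH.continuousOn hw hd hd1 hr) ?_ ?_ (hw.norm.mul_const C) ?_
  · filter_upwards [hev] with r' hr'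
    exact (integrable_mul_dilation hH.continuousOn hw hd hd1 (hr'.trans hR2)).aestronglyMeasurable
  · refine hw.aestronglyMeasurable.mul (Measurable.aestronglyMeasurable ?_)
    exact ContinuousLinearMap.measurable_apply₂.comp
      (((measurable_fderiv ℝ H).comp (hd.const_smul r)).prodMk hd)
  · filter_upwards [hd1] with a ha r' hr'
    rw [norm_mul]
    refine mul_le_mul_of_nonneg_left ?_ (norm_nonneg _)
    have h1 := hC _ (norm_smul_lt hr' ha).le
    exact (ContinuousLinearMap.le_opNorm _ _).trans
      ((mul_le_of_le_one_right (norm_nonneg _) ha).trans h1)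
  · filter_upwards [hd1] with a ha r' hr'
    exact (hH.hasDerivAt_dilation (norm_smul_lt (lt_trans hr' hR2) ha)).const_mul (w a)

end Dilation

/-! ### Spherical coordinates -/

section Spherical

theorem integrable_sphere_prod {E : Type*} [NormedAddCommGroup E] [NormedSpace ℝ E]
    [FiniteDimensional ℝ E] [MeasurableSpace E] [BorelSpace E] [Nontrivial E] (μ : Measure E)
    [μ.IsAddHaarMeasure] {f : E → ℝ} (hf : Integrable f μ) :
    Integrable (fun p : sphere (0 : E) 1 × Ioi (0 : ℝ) => f (p.2.1 • p.1.1))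
      (μ.toSphere.prod (.volumeIoiPow (Module.finrank ℝ E - 1))) ∧
    ∫ x, f x ∂μ = ∫ p : sphere (0 : E) 1 × Ioi (0 : ℝ), f (p.2.1 • p.1.1)
      ∂(μ.toSphere.prod (.volumeIoiPow (Module.finrank ℝ E - 1))) := by
  have hmp := μ.measurePreserving_homeomorphUnitSphereProd
  have hemb := (homeomorphUnitSphereProd E).measurableEmbedding
  have hcomp : ∀ x : ({(0)}ᶜ : Set E), f ((homeomorphUnitSphereProd E x).2.1 •
      (homeomorphUnitSphereProd E x).1.1) = f x := by
    intro x
    have : ‖x.1‖ ≠ 0 := norm_ne_zero_iff.2 x.2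
    simp [smul_smul, this]
  constructor
  · rw [← hmp.integrable_comp_emb hemb]
    simp only [Function.comp_def, hcomp]
    have h1 : IntegrableOn f ({0}ᶜ) μ := hf.integrableOn
    rwa [integrableOn_iff_comap_subtypeVal (measurableSet_singleton _).compl] at h1
  · rw [← hmp.integral_comp hemb]
    simp only [hcomp]
    rw [integral_subtype_comap (measurableSet_singleton _).compl f, restrict_compl_singleton]

theorem integral_eq_integral_sphere {f : Space 3 → ℝ} (hf : Integrable f) :
    ∫ x, f x = ∫ r in Ioi (0 : ℝ), r ^ 2 * ∫ e, f (r • (e : Space 3)) ∂sphereMeasure := by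
  obtain ⟨h1, h2⟩ := integrable_sphere_prod volume hf
  have hdim : Module.finrank ℝ (Space 3) - 1 = 2 := by simp
  rw [hdim] at h1 h2
  rw [h2, integral_prod_symm _ h1]
  simp only [Measure.volumeIoiPow, ENNReal.ofReal]
  rw [integral_withDensity_eq_integral_smul,
    integral_subtype_comap measurableSet_Ioi fun a => Real.toNNReal (a ^ 2) •
      ∫ e : sphere (0 : Space 3) 1, f (a • (e : Space 3)) ∂volume.toSphere]
  · refine setIntegral_congr_fun measurableSet_Ioi fun r hr => ?_
    simp only [NNReal.smul_def, Real.coe_toNNReal _ (sq_nonneg r), smul_eq_mul, sphereMeasure]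
  · exact (measurable_subtype_coe.pow_const _).real_toNNReal

instance : IsFiniteMeasure sphereMeasure := by unfold sphereMeasure; infer_instance

theorem integral_ball_eq {T : ℝ} {H : Space 3 → ℝ} (hH : ContinuousOn H (ball 0 T)) {R : ℝ}
    (hR : R < T) (hR0 : 0 ≤ R) :
    ∫ y in closedBall 0 R, H y =
      ∫ r in (0 : ℝ)..R, r ^ 2 * ∫ e, H (r • (e : Space 3)) ∂sphereMeasure := by
  have hint : IntegrableOn H (closedBall 0 R) :=
    (hH.mono (closedBall_subset_ball hR)).integrableOn_compact (isCompact_closedBall _ _)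
  rw [← integral_indicator measurableSet_closedBall,
    integral_eq_integral_sphere (hint.integrable_indicator measurableSet_closedBall),
    intervalIntegral.integral_of_le hR0, ← Ioi_inter_Iic,
    ← setIntegral_indicator (μ := volume) (s := Ioi 0) (measurableSet_Iic (a := R))]
  refine setIntegral_congr_fun measurableSet_Ioi fun r hr => ?_
  have hn : ∀ e : sphere (0 : Space 3) 1, ‖r • (e : Space 3)‖ = r := fun e => by
    rw [norm_smul, norm_eq_of_mem_sphere e, mul_one, Real.norm_of_nonneg (le_of_lt hr)]
  by_cases h : r ≤ R
  · simp [indicator, hn, h]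
  · simp [indicator, hn, h]

end Spherical

/-! ### The delta kernel in three dimensions -/

theorem leadingExponent_three : leadingExponent 3 = -1 := by norm_num [leadingExponent]

theorem gsOrder_neg_one : gsOrder (-1) = 1 := by simp [gsOrder]

/-- The first primitive of the kernel is the Heaviside function, so the generalized integral is the
s-derivative of an integral over the ball of radius √s. -/
theorem gsFun_zero (ς : ℝ) : gsFun (-1 + (1 : ℕ)) ς = if ς < 0 then 0 else 1 := by
  simp [gsFun, realFactorial]

theorem gsFun_of_neg (l : ℝ) : ∀ ς < 0, gsFun l ς = 0 := fun ς h => by simp [gsFun, h]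

section ThreeDimensions

variable {T : ℝ} {H : Space 3 → ℝ}

theorem integrableOn_gsFun_zero (hH : ContinuousOn H (ball 0 T)) {s : ℝ}
    (hT : 0 < T) (hs : s < T ^ 2) :
    IntegrableOn (fun y => gsFun (-1 + (1 : ℕ)) (s - ‖y‖ ^ 2) * H y) (ball 0 T) := by
  have hsub : closedBall (0 : Space 3) √s ⊆ ball 0 T :=
    closedBall_subset_ball ((Real.sqrt_lt' hT).2 hs)
  have h1 : IntegrableOn H (closedBall 0 √s) :=
    (hH.mono hsub).integrableOn_compact (isCompact_closedBall _ _)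
  have h2 := (h1.mono_set (s := closedBall 0 √s ∩ {y | ‖y‖ ^ 2 ≤ s}) inter_subset_left)
  have hm : MeasurableSet (closedBall (0 : Space 3) √s ∩ {y | ‖y‖ ^ 2 ≤ s}) :=
    measurableSet_closedBall.inter (measurableSet_le (by fun_prop) (by fun_prop))
  refine ((h2.integrable_indicator hm).integrableOn (s := ball 0 T)).congr_fun (fun y _ => ?_)
    measurableSet_ball
  simp only [gsFun_zero, indicator]
  by_cases h : ‖y‖ ^ 2 ≤ s
  · have h3 : ‖y‖ ≤ √s := Real.le_sqrt_of_sq_le h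
    simp [h, h3, not_lt.2 h]
  · simp [h, not_le.1 h]

theorem integral_gsFun_zero (hH : ContinuousOn H (ball 0 T)) {s : ℝ} (hT : 0 < T) (hs0 : 0 ≤ s)
    (hs : s < T ^ 2) :
    ∫ y in ball 0 T, gsFun (-1 + (1 : ℕ)) (s - ‖y‖ ^ 2) * H y =
      ∫ r in (0 : ℝ)..√s, r ^ 2 * ∫ e, H (r • (e : Space 3)) ∂sphereMeasure := by
  have hR := (Real.sqrt_lt' hT).2 hs
  have hsub : closedBall (0 : Space 3) √s ⊆ ball 0 T := closedBall_subset_ball hR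
  rw [← integral_ball_eq hH hR (Real.sqrt_nonneg s), ← inter_eq_right.2 hsub,
    ← setIntegral_indicator measurableSet_closedBall]
  refine setIntegral_congr_fun measurableSet_ball fun y _ => ?_
  have : ‖y‖ ≤ √s ↔ ¬ (s - ‖y‖ ^ 2 < 0) := by
    rw [Real.le_sqrt (norm_nonneg _) hs0, not_lt, sub_nonneg]
  simp only [gsFun_zero, indicator, mem_closedBall_zero_iff, this]
  by_cases h : s - ‖y‖ ^ 2 < 0 <;> simp [h]

/-- The integral over the unit sphere of the values of `H` at distance `r`. -/
def sphereIntegral (H : Space 3 → ℝ) (r : ℝ) : ℝ := ∫ e, H (r • (e : Space 3)) ∂sphereMeasure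

theorem continuousAt_sphereIntegral (hH : ContinuousOn H (ball 0 T)) {r : ℝ} (hr : |r| < T) :
    ContinuousAt (sphereIntegral H) r := by
  simpa [sphereIntegral] using! continuousAt_integral_dilation
    (μ := sphereMeasure) (w := fun _ => 1)
    (d := fun e => (e : Space 3)) hH (integrable_const _) measurable_subtype_coe
    (Eventually.of_forall fun e => (norm_eq_of_mem_sphere e).le) hr

theorem hasDerivAt_sphereIntegral (hH : ContDiffOn ℝ 1 H (ball 0 T)) {r : ℝ} (hr : |r| < T) :
    Integrable (fun e : sphere (0 : Space 3) 1 => fderiv ℝ H (r • (e : Space 3)) e) sphereMeasure ∧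
    HasDerivAt (sphereIntegral H)
      (∫ e : sphere (0 : Space 3) 1, fderiv ℝ H (r • (e : Space 3)) e ∂sphereMeasure) r := by
  simpa [sphereIntegral] using! hasDerivAt_integral_dilation (μ := sphereMeasure) (w := fun _ => 1)
    (d := fun e => (e : Space 3)) hH (integrable_const _) measurable_subtype_coe
    (Eventually.of_forall fun e => (norm_eq_of_mem_sphere e).le) hr

theorem integrable_sphere (hH : ContinuousOn H (ball 0 T)) {r : ℝ} (hr : |r| < T) :
    Integrable (fun e : sphere (0 : Space 3) 1 => H (r • (e : Space 3))) sphereMeasure := by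
  simpa using! integrable_mul_dilation (μ := sphereMeasure) (w := fun _ => 1)
    (d := fun e => (e : Space 3)) hH (integrable_const _) measurable_subtype_coe
    (Eventually.of_forall fun e => (norm_eq_of_mem_sphere e).le) hr

theorem hasDerivAt_primitive (hH : ContinuousOn H (ball 0 T)) {s : ℝ} (hT : 0 < T)
    (hs0 : 0 < s) (hs : s < T ^ 2) :
    HasDerivAt (fun s => ∫ r in (0 : ℝ)..√s, r ^ 2 * sphereIntegral H r)
      (√s / 2 * sphereIntegral H √s) s := by
  have hR := (Real.sqrt_lt' hT).2 hs
  have hcont : ContinuousOn (fun r => r ^ 2 * sphereIntegral H r) (Ioo (-T) T) := fun r hr =>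
    ((continuousAt_id.pow 2).mul
      (continuousAt_sphereIntegral hH (abs_lt.2 hr))).continuousWithinAt
  have hmem : √s ∈ Ioo (-T) T := ⟨(neg_lt_zero.2 hT).trans_le (Real.sqrt_nonneg _), hR⟩
  have h1 : HasDerivAt (fun R => ∫ r in (0 : ℝ)..R, r ^ 2 * sphereIntegral H r)
      (√s ^ 2 * sphereIntegral H √s) √s := by
    refine intervalIntegral.integral_hasDerivAt_right ?_
      (hcont.stronglyMeasurableAtFilter isOpen_Ioo _ hmem)
      (hcont.continuousAt (isOpen_Ioo.mem_nhds hmem))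
    refine (hcont.mono ?_).intervalIntegrable
    rw [uIcc_of_le (Real.sqrt_nonneg _)]
    exact fun r hr => ⟨(neg_lt_zero.2 hT).trans_le hr.1, hr.2.trans_lt hR⟩
  -- The factor √s/2 is the surface density (√s)² times the derivative 1/(2√s) of the radius.
  refine (h1.comp s (Real.hasDerivAt_sqrt hs0.ne')).congr_deriv ?_
  have := (Real.sqrt_pos.2 hs0).ne'
  field_simp

end ThreeDimensions

/-! ### The leading term in three dimensions -/

section LeadingThree

variable {ρ ν : Space 3 → ℝ} {x₀ : Space 3} {T : ℝ} {X : Space 3 → Space 3} {v₀ : Space 3 → ℝ}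
  (hρ : ∀ x, 0 < ρ x) (hν : ∀ x, 0 < ν x) (hρd : ContDiff ℝ 1 ρ) (hνd : ContDiff ℝ 1 ν)
  (hX : CausticFree (speed ρ ν) x₀ T X) (hX0 : X 0 = x₀) (hv : IsLeadingCoeff ρ ν x₀ T v₀)

include hρ hν hρd hνd hX hX0 hv

theorem hasDerivAt_gsPrimitive_three {φ : Space 3 → ℝ} (hφ : Continuous φ) {s : ℝ} (hT : 0 < T)
    (hs0 : 0 < s) (hs : s < T ^ 2) :
    HasDerivAt (gsPrimitive (-1) (travelTime (speed ρ ν) x₀) fun x => v₀ x * φ x)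
      (√s / 2 * sphereIntegral (pullback ρ ν x₀ X v₀ φ) √s) s := by
  have hH := hv.continuousOn_pullback hρ hν hρd hνd hX hX0 hφ
  refine (hasDerivAt_primitive hH hT hs0 hs).congr_of_eventuallyEq ?_
  filter_upwards [isOpen_Ioo.mem_nhds (⟨hs0, hs⟩ : s ∈ Ioo 0 (T ^ 2))] with r hr
  rw [gsPrimitive, gsOrder_neg_one,
    hv.integral_eq hρ hν hρd hνd hX hX0 (gsFun_of_neg _) hT hr.2,
    integral_gsFun_zero hH hT hr.1.le hr.2]
  rfl

theorem leadingTermRegular_three {φ : Space 3 → ℝ} (hφ : Continuous φ) {t : ℝ} (ht0 : 0 < t)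
    (ht : t < T) : LeadingTermRegular (travelTime (speed ρ ν) x₀) v₀ t φ := by
  have hT := ht0.trans ht
  have hH := hv.continuousOn_pullback hρ hν hρd hνd hX hX0 hφ
  have hmem : Ioo 0 (T ^ 2) ∈ 𝓝 (t ^ 2) :=
    isOpen_Ioo.mem_nhds ⟨by positivity, by gcongr⟩
  rw [LeadingTermRegular, leadingExponent_three, GSRegular, gsOrder_neg_one]
  constructor
  · filter_upwards [hmem] with r hr
    exact (hv.integrable_iff hρ hν hρd hνd hX hX0 (gsFun_of_neg _) hT hr.2 φ).2
      (integrableOn_gsFun_zero hH hT hr.2)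
  · rw [Nat.cast_one, contDiffAt_one_iff]
    refine ⟨fun s => ContinuousLinearMap.toSpanSingleton ℝ
      (√s / 2 * sphereIntegral (pullback ρ ν x₀ X v₀ φ) √s), _, hmem, ?_, fun s hs =>
      (hasDerivAt_gsPrimitive_three hρ hν hρd hνd hX hX0 hv hφ hT hs.1 hs.2).hasFDerivAt⟩
    intro s hs
    have h1 : ContinuousAt (fun s => sphereIntegral (pullback ρ ν x₀ X v₀ φ) √s) s := by
      refine ContinuousAt.comp (f := fun s : ℝ => √s) (continuousAt_sphereIntegral hH ?_)
        Real.continuous_sqrt.continuousAt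
      rw [abs_of_nonneg (Real.sqrt_nonneg s)]
      exact (Real.sqrt_lt' hT).2 hs.2
    have h2 : ContinuousAt (fun s => √s / 2 * sphereIntegral (pullback ρ ν x₀ X v₀ φ) √s) s :=
      (Real.continuous_sqrt.continuousAt.div_const 2).mul h1
    exact (ContinuousAt.comp (g := ContinuousLinearMap.toSpanSingleton ℝ)
      (ContinuousLinearMap.toSpanSingletonCLE (𝕜 := ℝ) (E := ℝ)).continuous.continuousAt
      h2).continuousWithinAt

theorem leadingTerm_three {φ : Space 3 → ℝ} (hφ : Continuous φ) {t : ℝ} (ht0 : 0 < t)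
    (ht : t < T) : leadingTerm (travelTime (speed ρ ν) x₀) v₀ t φ =
      t / 2 * sphereIntegral (pullback ρ ν x₀ X v₀ φ) t := by
  have h := (hasDerivAt_gsPrimitive_three hρ hν hρd hνd hX hX0 hv hφ (ht0.trans ht)
    (s := t ^ 2) (by positivity) (by gcongr)).deriv
  rw [leadingTerm, gsIntegral, leadingExponent_three, gsOrder_neg_one, iteratedDeriv_one, h,
    Real.sqrt_sq ht0.le]

theorem hasDerivAt_leadingTerm_three {u : Space 3 → ℝ} (hu : ContDiff ℝ 1 u) {t : ℝ} (ht0 : 0 < t)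
    (ht : t < T) :
    HasDerivAt (fun r => leadingTerm (travelTime (speed ρ ν) x₀) v₀ r fun x => ρ x * u x)
      (1 / 2 * sphereIntegral (pullback ρ ν x₀ X v₀ fun x => ρ x * u x) t +
        t / 2 * ∫ e : sphere (0 : Space 3) 1,
          fderiv ℝ (pullback ρ ν x₀ X v₀ fun x => ρ x * u x) (t • (e : Space 3)) e
            ∂sphereMeasure) t := by
  have hH := hv.contDiffOn_pullback hρ hν hρd hνd hX hX0 hu
  have h1 := ((hasDerivAt_id t).div_const 2).mul (hasDerivAt_sphereIntegral hH (r := t)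
    (by rwa [abs_of_pos ht0])).2
  refine h1.congr_of_eventuallyEq ?_
  filter_upwards [isOpen_Ioo.mem_nhds (⟨ht0, ht⟩ : t ∈ Ioo 0 T)] with r hr
  exact leadingTerm_three hρ hν hρd hνd hX hX0 hv (hρd.continuous.mul hu.continuous) hr.1 hr.2

end LeadingThree

/-- The datum u carries the time derivative and f = ρw does not. U uses (u, w) = (u¹, u²) and V uses
(u², ρ⁻¹∇·(ν∇u¹)). The 8 in the denominators is the 4 of `energyConst` doubled by the factor t/2. -/
theorem hadamard_kirchhoff_huygens_three (ρ ν : Space 3 → ℝ) (hρd : ContDiff ℝ 1 ρ)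
    (hνd : ContDiff ℝ 1 ν)
    (hρ : ∀ x, 0 < ρ x) (hν : ∀ x, 0 < ν x) (x₀ : Space 3) (T : ℝ) (X : Space 3 → Space 3)
    (hX : CausticFree (speed ρ ν) x₀ T X) (v₀ : Space 3 → ℝ) (hv : IsLeadingCoeff ρ ν x₀ T v₀)
    (u w f : Space 3 → ℝ) (hu : ContDiff ℝ 1 u) (hf : Continuous f) (hfw : ∀ x, f x = ρ x * w x)
    (t : ℝ) (ht0 : 0 < t) (ht : t < T) :
    LeadingTermRegular (travelTime (speed ρ ν) x₀) v₀ t (fun x => ρ x * u x) ∧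
    LeadingTermRegular (travelTime (speed ρ ν) x₀) v₀ t f ∧
    DifferentiableAt ℝ
      (fun r => leadingTerm (travelTime (speed ρ ν) x₀) v₀ r (fun x => ρ x * u x)) t ∧
    Integrable (fun e : sphere (0 : Space 3) 1 =>
      t * (w (X (t • (e : Space 3))) /
          (8 * ρ x₀ * speed ρ ν x₀ ^ 3 * Real.pi ^ 2 * v₀ (X (t • (e : Space 3)))))
        + u (X (t • (e : Space 3))) /
          (8 * ρ x₀ * speed ρ ν x₀ ^ 3 * Real.pi ^ 2 * v₀ (X (t • (e : Space 3))))
        + t * rayDeriv ρ ν x₀ (fun y => u y / (8 * ρ x₀ * speed ρ ν x₀ ^ 3 * Real.pi ^ 2 * v₀ y))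
          (X (t • (e : Space 3)))) sphereMeasure ∧
    leadingTerm (travelTime (speed ρ ν) x₀) v₀ t f +
      deriv (fun r => leadingTerm (travelTime (speed ρ ν) x₀) v₀ r (fun x => ρ x * u x)) t =
      ∫ e : sphere (0 : Space 3) 1, (t * (w (X (t • (e : Space 3))) /
          (8 * ρ x₀ * speed ρ ν x₀ ^ 3 * Real.pi ^ 2 * v₀ (X (t • (e : Space 3)))))
        + u (X (t • (e : Space 3))) /
          (8 * ρ x₀ * speed ρ ν x₀ ^ 3 * Real.pi ^ 2 * v₀ (X (t • (e : Space 3))))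
        + t * rayDeriv ρ ν x₀ (fun y => u y / (8 * ρ x₀ * speed ρ ν x₀ ^ 3 * Real.pi ^ 2 * v₀ y))
          (X (t • (e : Space 3)))) ∂sphereMeasure := by
  have hX0 := hX.apply_zero
  have hρu : Continuous fun x => ρ x * u x := hρd.continuous.mul hu.continuous
  have hd := hasDerivAt_leadingTerm_three hρ hν hρd hνd hX hX0 hv hu ht0 ht
  have habs : |t| < T := by rwa [abs_of_pos ht0]
  have hE : energyConst ρ ν x₀ = 1 / (4 * ρ x₀ * speed ρ ν x₀ ^ 3 * Real.pi ^ 2) := by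
    norm_num [energyConst]
  have hE0 := (energyConst_pos (x₀ := x₀) hρ hν).ne'
  set P := pullback ρ ν x₀ X v₀ fun x => ρ x * u x with hP
  set Q := pullback ρ ν x₀ X v₀ f with hQ
  have hQP : ∀ (e : sphere (0 : Space 3) 1),
      t * (w (X (t • (e : Space 3))) /
          (8 * ρ x₀ * speed ρ ν x₀ ^ 3 * Real.pi ^ 2 * v₀ (X (t • (e : Space 3)))))
        + u (X (t • (e : Space 3))) /
          (8 * ρ x₀ * speed ρ ν x₀ ^ 3 * Real.pi ^ 2 * v₀ (X (t • (e : Space 3))))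
        + t * rayDeriv ρ ν x₀ (fun y => u y / (8 * ρ x₀ * speed ρ ν x₀ ^ 3 * Real.pi ^ 2 * v₀ y))
          (X (t • (e : Space 3))) =
      t / 2 * Q (t • (e : Space 3)) + 1 / 2 * P (t • (e : Space 3)) +
        t / 2 * fderiv ℝ P (t • (e : Space 3)) e := by
    intro e
    have hk : (fun y => u y / (8 * ρ x₀ * speed ρ ν x₀ ^ 3 * Real.pi ^ 2 * v₀ y)) =
        fun y => (energyConst ρ ν x₀ / 2) * (u y / v₀ y) := by
      funext y
      rw [hE, div_div, div_mul_div_comm, one_mul]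
      congr 1
      ring
    rw [hk, hv.rayDeriv_eq hρ hν hρd hνd hX hX0 hu (norm_eq_of_mem_sphere e) ht0 ht, ← hP]
    have h1 := (hρ (X (t • (e : Space 3)))).ne'
    have h2 := congrFun hk (X (t • (e : Space 3)))
    have h3 : w (X (t • (e : Space 3))) /
        (8 * ρ x₀ * speed ρ ν x₀ ^ 3 * Real.pi ^ 2 * v₀ (X (t • (e : Space 3)))) =
        (energyConst ρ ν x₀ / 2) * (w (X (t • (e : Space 3))) / v₀ (X (t • (e : Space 3)))) := by
      rw [hE, div_div, div_mul_div_comm, one_mul]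
      congr 1
      ring
    rw [h2, h3, hP, hQ, pullback, pullback, hfw, mul_div_mul_left _ _ h1, mul_div_mul_left _ _ h1]
    field_simp
  have hcP : ContDiffOn ℝ 1 P (ball 0 T) := hv.contDiffOn_pullback hρ hν hρd hνd hX hX0 hu
  have hcQ : ContinuousOn Q (ball 0 T) := hv.continuousOn_pullback hρ hν hρd hνd hX hX0 hf
  have i1 := (integrable_sphere hcQ habs).const_mul (t / 2)
  have i2 := (integrable_sphere hcP.continuousOn habs).const_mul (1 / 2)
  have i3 := (hasDerivAt_sphereIntegral hcP habs).1.const_mul (t / 2)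
  refine ⟨leadingTermRegular_three hρ hν hρd hνd hX hX0 hv hρu ht0 ht,
    leadingTermRegular_three hρ hν hρd hνd hX hX0 hv hf ht0 ht, hd.differentiableAt, ?_, ?_⟩
  · simp only [hQP]
    exact (i1.add i2).add i3
  · simp only [hQP]
    have i12 : Integrable (fun e : sphere (0 : Space 3) 1 => t / 2 * Q (t • (e : Space 3)) +
        1 / 2 * P (t • (e : Space 3))) sphereMeasure := i1.add i2
    rw [integral_add i12 i3, integral_add i1 i2, integral_const_mul, integral_const_mul,
      integral_const_mul, hd.deriv, leadingTerm_three hρ hν hρd hνd hX hX0 hv hf ht0 ht]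
    simp only [sphereIntegral]
    ring

/-! ### Polar coordinates in the plane -/

section Polar

theorem direction_sub_pi (θ : ℝ) : direction (θ + -Real.pi) = -direction θ := by
  ext i
  fin_cases i <;> simp [direction, ← sub_eq_add_neg, Real.cos_sub_pi, Real.sin_sub_pi]

theorem norm_direction (θ : ℝ) : ‖direction θ‖ = 1 := by
  simp [direction, EuclideanSpace.norm_eq]

theorem continuous_direction : Continuous direction := by
  unfold direction
  fun_prop

/-- The standard polar chart uses angles in (-π, π). The shift by π reverses the direction vector,
and the reflection x ↦ -x undoes this. -/
theorem integral_polar (f : Space 2 → ℝ) :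
    ∫ x, f x = ∫ q in Ioi (0 : ℝ) ×ˢ Ioo 0 (2 * Real.pi), q.1 * f (q.1 • direction q.2) := by
  have e1 := (PiLp.volume_preserving_toLp (Fin 2)).integral_comp
    (MeasurableEquiv.toLp 2 (Fin 2 → ℝ)).measurableEmbedding fun x => f (-x)
  have e2 := (volume_preserving_finTwoArrow ℝ).symm.integral_comp
    (MeasurableEquiv.finTwoArrow (α := ℝ)).symm.measurableEmbedding
    fun x => f (-(WithLp.toLp 2 x : Space 2))
  have e3 := integral_comp_polarCoord_symm fun p : ℝ × ℝ => f (-!₂[p.1, p.2])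
  have e4 := (measurePreserving_add_right volume ((0 : ℝ), -Real.pi)).setIntegral_preimage_emb
    (measurableEmbedding_addRight _) (fun q : ℝ × ℝ => q.1 * f (-(q.1 • direction q.2)))
    polarCoord.target
  rw [← integral_neg_eq_self f, ← e1, ← e2]
  have e5 : ∀ p : ℝ × ℝ, WithLp.toLp 2 (MeasurableEquiv.finTwoArrow.symm p) =
      (!₂[p.1, p.2] : Space 2) := by
    intro p
    ext i
    fin_cases i <;> rfl
  simp only [e5]
  rw [← e3]
  have e6 : ∀ q : ℝ × ℝ, !₂[(polarCoord.symm q).1, (polarCoord.symm q).2] =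
      q.1 • direction q.2 := by
    intro q
    ext i
    fin_cases i <;> simp [direction]
  simp only [e6, smul_eq_mul]
  rw [← e4]
  have e7 : (fun x : ℝ × ℝ => x + (0, -Real.pi)) ⁻¹' polarCoord.target =
      Ioi (0 : ℝ) ×ˢ Ioo 0 (2 * Real.pi) := by
    ext q
    simp only [polarCoord_target, mem_preimage, mem_prod, mem_Ioi, mem_Ioo, Prod.fst_add,
      Prod.snd_add, add_zero]
    constructor <;> rintro ⟨h1, h2, h3⟩ <;> refine ⟨h1, ?_, ?_⟩ <;> linarith
  rw [e7]
  simp only [Prod.fst_add, Prod.snd_add, add_zero, direction_sub_pi, smul_neg, neg_neg]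

end Polar

/-! ### The Abel kernel -/

section AbelKernel

/-- Factor t² - r² = (t + r)(t - r): the first factor is at least t, and (t - r)^(-1/2) is
integrable. -/
theorem intervalIntegrable_abelKernel {t : ℝ} (ht : 0 < t) :
    IntervalIntegrable (fun r => (t ^ 2 - r ^ 2) ^ (-(1 / 2) : ℝ)) volume 0 t := by
  have h1 : IntervalIntegrable (fun r : ℝ => (t - r) ^ (-(1 / 2) : ℝ)) volume 0 t := by
    have := (intervalIntegral.intervalIntegrable_rpow' (a := 0) (b := t) (r := -(1 / 2))
      (by norm_num)).comp_sub_left t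
    simpa using this.symm
  refine (h1.const_mul (t ^ (-(1 / 2) : ℝ))).mono_fun' ?_ ?_
  · exact (Measurable.pow_const (by fun_prop) _).aestronglyMeasurable
  · rw [uIoc_of_le ht.le]
    filter_upwards [ae_restrict_mem measurableSet_Ioc] with r hr
    rcases hr.2.eq_or_lt with h | h
    · subst h
      rw [sub_self, Real.zero_rpow (by norm_num)]
      simp
    · have h2 : 0 < t - r := sub_pos.2 h
      have h3 : t ^ 2 - r ^ 2 = (t + r) * (t - r) := by ring
      have h4 : 0 < t + r := add_pos ht hr.1
      rw [Real.norm_of_nonneg (Real.rpow_nonneg (by rw [h3]; positivity) _), h3,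
        Real.mul_rpow h4.le h2.le]
      refine mul_le_mul_of_nonneg_right ?_ (Real.rpow_nonneg h2.le _)
      exact Real.rpow_le_rpow_of_nonpos ht (by linarith [hr.1]) (by norm_num)

/-- The domain of integration in polar coordinates. -/
def polarDomain (t : ℝ) : Set (ℝ × ℝ) := Ioo 0 t ×ˢ Ioo 0 (2 * Real.pi)

theorem measurableSet_polarDomain (t : ℝ) : MeasurableSet (polarDomain t) :=
  measurableSet_Ioo.prod measurableSet_Ioo

theorem volume_restrict_polarDomain (t : ℝ) : (volume : Measure (ℝ × ℝ)).restrict (polarDomain t) =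
    (volume.restrict (Ioo 0 t)).prod (volume.restrict (Ioo 0 (2 * Real.pi))) := by
  rw [Measure.prod_restrict]; rfl

theorem integrableOn_abelKernel {t : ℝ} (ht : 0 < t) :
    IntegrableOn (fun q : ℝ × ℝ => (t ^ 2 - q.1 ^ 2) ^ (-(1 / 2) : ℝ)) (polarDomain t) := by
  have h1 := (intervalIntegrable_iff_integrableOn_Ioo_of_le ht.le).1
    (intervalIntegrable_abelKernel ht)
  rw [IntegrableOn, volume_restrict_polarDomain]
  exact Integrable.comp_fst h1 _

theorem abelIntegrable_of_bound {t : ℝ} (ht : 0 < t) {F : ℝ → ℝ → ℝ} {C : ℝ}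
    (hF : AEStronglyMeasurable (fun q : ℝ × ℝ => F q.1 q.2) (volume.restrict (polarDomain t)))
    (hC : ∀ q ∈ polarDomain t, ‖F q.1 q.2‖ ≤ C) : AbelIntegrable t F :=
  (integrableOn_abelKernel ht).mul_bdd (c := C) hF
    ((ae_restrict_mem (measurableSet_polarDomain t)).mono hC)

theorem AbelIntegrable.setIntegral_eq {t : ℝ} (ht : 0 < t) {F : ℝ → ℝ → ℝ}
    (hF : AbelIntegrable t F) :
    ∫ q in polarDomain t, (t ^ 2 - q.1 ^ 2) ^ (-(1 / 2) : ℝ) * F q.1 q.2 = abelIntegral t F := by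
  have hF' : Integrable (fun q : ℝ × ℝ => (t ^ 2 - q.1 ^ 2) ^ (-(1 / 2) : ℝ) * F q.1 q.2)
      ((volume.restrict (Ioo 0 t)).prod (volume.restrict (Ioo 0 (2 * Real.pi)))) := by
    rw [← volume_restrict_polarDomain]; exact hF
  rw [volume_restrict_polarDomain, integral_prod_symm _ hF', abelIntegral,
    intervalIntegral.integral_of_le Real.two_pi_pos.le, integral_Ioc_eq_integral_Ioo]
  refine integral_congr_ae (Eventually.of_forall fun θ => ?_)
  simp only
  rw [intervalIntegral.integral_of_le ht.le, integral_Ioc_eq_integral_Ioo]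

/-- Under r = tz the kernel scales by 1/t and dr by t. The remaining dependence on t sits in F, away
from the singular kernel. -/
theorem abelIntegral_scale {t : ℝ} (ht : 0 < t) (F : ℝ → ℝ → ℝ) :
    abelIntegral t F = abelIntegral 1 fun z θ => F (t * z) θ := by
  refine intervalIntegral.integral_congr fun θ _ => ?_
  have h := intervalIntegral.smul_integral_comp_mul_left (a := 0) (b := 1)
    (fun r => (t ^ 2 - r ^ 2) ^ (-(1 / 2) : ℝ) * F r θ) t
  rw [mul_zero, mul_one] at h
  simp only
  rw [← h, ← intervalIntegral.integral_smul]
  refine intervalIntegral.integral_congr fun z hz => ?_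
  rw [uIcc_of_le zero_le_one] at hz
  have h1 : 0 ≤ 1 - z ^ 2 := by nlinarith [hz.1, hz.2]
  have h2 : t ^ 2 - (t * z) ^ 2 = t ^ 2 * (1 - z ^ 2) := by ring
  have h3 : (t ^ 2) ^ (-(1 / 2) : ℝ) = t⁻¹ := by
    rw [← Real.rpow_natCast, ← Real.rpow_mul ht.le]
    norm_num [Real.rpow_neg_one]
  simp only [smul_eq_mul]
  rw [h2, Real.mul_rpow (sq_nonneg t) h1, h3, one_pow]
  field_simp

/-- The integrand is the derivative of -√(1 - z²) g(z), which vanishes at z = 1 and equals -g(0) at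
z = 0. -/
theorem integral_abelKernel_by_parts {g g' : ℝ → ℝ}
    (hg : ∀ z ∈ Icc (0 : ℝ) 1, HasDerivAt g (g' z) z)
    (hg' : ContinuousOn g' (Icc 0 1)) :
    ∫ z in (0 : ℝ)..1, ((1 : ℝ) ^ 2 - z ^ 2) ^ (-(1 / 2) : ℝ) * (z * g z + z ^ 2 * g' z - g' z) =
      g 0 := by
  have hgc : ContinuousOn g (Icc 0 1) := fun z hz => (hg z hz).continuousAt.continuousWithinAt
  have hcont : ContinuousOn (fun z => z * g z + z ^ 2 * g' z - g' z) (uIcc 0 1) := by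
    rw [uIcc_of_le zero_le_one]
    fun_prop
  have hint := (intervalIntegrable_abelKernel one_pos).mul_continuousOn hcont
  rw [intervalIntegral.integral_eq_sub_of_hasDerivAt_of_le zero_le_one
    (f := fun z => -(√(1 - z ^ 2) * g z)) (by fun_prop) ?_ hint]
  · simp
  · intro z hz
    have hz1 : 0 < 1 - z ^ 2 := by nlinarith [hz.1, hz.2]
    have h1 : HasDerivAt (fun z : ℝ => 1 - z ^ 2) (-(2 * z)) z := by
      simpa using (hasDerivAt_pow 2 z).const_sub 1
    refine (((h1.sqrt hz1.ne').mul (hg z (Ioo_subset_Icc_self hz))).neg).congr_deriv ?_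
    have h2 : ((1 : ℝ) ^ 2 - z ^ 2) ^ (-(1 / 2) : ℝ) = (√(1 - z ^ 2))⁻¹ := by
      rw [one_pow, Real.rpow_neg hz1.le, ← Real.sqrt_eq_rpow]
    rw [h2]
    have h3 := (Real.sqrt_pos.2 hz1).ne'
    have h4 := Real.sq_sqrt hz1.le
    field_simp
    rw [h4]
    ring

end AbelKernel

/-! ### The leading term in two dimensions -/

theorem leadingExponent_two : leadingExponent 2 = -(1 / 2) := by norm_num [leadingExponent]

theorem gsOrder_neg_half : gsOrder (-(1 / 2)) = 0 := by
  rw [gsOrder, Nat.floor_eq_zero]; norm_num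

theorem realFactorial_neg_half : realFactorial (-(1 / 2)) = √Real.pi := by
  rw [realFactorial, ← Real.Gamma_one_half_eq]; norm_num

section TwoDimensions

variable {T : ℝ} {H : Space 2 → ℝ}

theorem gsFun_neg_half {t r : ℝ} (hr : 0 ≤ r) (ht : 0 ≤ t) :
    gsFun (-(1 / 2) + (0 : ℕ)) (t ^ 2 - r ^ 2) = if r < t then
      (t ^ 2 - r ^ 2) ^ (-(1 / 2) : ℝ) / realFactorial (-(1 / 2)) else 0 := by
  rw [Nat.cast_zero, add_zero, gsFun]
  rcases lt_trichotomy r t with h | h | h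
  · rw [if_pos h, if_neg (by nlinarith)]
  -- On the wave front `0 ^ (-(1 / 2))` is 0 by convention, which matches the strict inequality.
  · subst h
    simp
  · rw [if_neg h.le.not_gt, if_pos (by nlinarith)]

theorem integrableOn_gsFun_neg_half (hH : ContinuousOn H (ball 0 T)) {t : ℝ} (ht0 : 0 < t)
    (ht : t < T) :
    IntegrableOn (fun y => gsFun (-(1 / 2) + (0 : ℕ)) (t ^ 2 - ‖y‖ ^ 2) * H y) (ball 0 T) := by
  classical
  have h1 : Integrable fun y : Space 2 => gsFun (-(1 / 2) + (0 : ℕ)) (t ^ 2 - ‖y‖ ^ 2) := by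
    refine (integrable_fun_norm_addHaar volume
      (f := fun r => gsFun (-(1 / 2) + (0 : ℕ)) (t ^ 2 - r ^ 2))).2 ?_
    have h2 : IntegrableOn (fun r => r * ((t ^ 2 - r ^ 2) ^ (-(1 / 2) : ℝ) /
        realFactorial (-(1 / 2)))) (Ioo 0 t) :=
      (intervalIntegrable_iff_integrableOn_Ioo_of_le ht0.le).1
        (((intervalIntegrable_abelKernel ht0).div_const _).continuousOn_mul continuousOn_id)
    refine ((h2.integrable_indicator measurableSet_Ioo).integrableOn (s := Ioi 0)).congr_fun
      (fun r hr => ?_) measurableSet_Ioi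
    have hr0 : 0 < r := hr
    simp only [gsFun_neg_half hr0.le ht0.le, indicator, mem_Ioo, hr0, true_and, smul_eq_mul]
    split_ifs <;> simp
  obtain ⟨C, hC⟩ := exists_bound_closedBall hH ht
  have hm : Measurable ((closedBall (0 : Space 2) t).piecewise H 0) :=
    (hH.mono (closedBall_subset_ball ht)).measurable_piecewise continuousOn_const
      measurableSet_closedBall
  have h3 : Integrable fun y => gsFun (-(1 / 2) + (0 : ℕ)) (t ^ 2 - ‖y‖ ^ 2) *
      (closedBall (0 : Space 2) t).piecewise H 0 y := by
    refine h1.mul_bdd (c := max C 0) hm.aestronglyMeasurable (Eventually.of_forall fun y => ?_)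
    by_cases h : y ∈ closedBall (0 : Space 2) t
    · rw [piecewise_eq_of_mem _ _ _ h]
      exact (hC y (by simpa using h)).trans (le_max_left _ _)
    · rw [piecewise_eq_of_notMem _ _ _ h]
      simp
  refine h3.integrableOn.congr_fun (fun y _ => ?_) measurableSet_ball
  by_cases h : y ∈ closedBall (0 : Space 2) t
  · simp only [piecewise_eq_of_mem _ _ _ h]
  · have h4 : ¬ ‖y‖ < t := fun h' => h (by simpa using h'.le)
    simp only [gsFun_neg_half (norm_nonneg y) ht0.le, if_neg h4, zero_mul]

theorem measurable_planar : Measurable fun q : ℝ × ℝ => q.1 • direction q.2 :=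
  (continuous_fst.smul (continuous_direction.comp continuous_snd)).measurable

theorem norm_smul_direction {r : ℝ} (hr : 0 ≤ r) (θ : ℝ) : ‖r • direction θ‖ = r := by
  rw [norm_smul, norm_direction, mul_one, Real.norm_of_nonneg hr]

theorem norm_planar_le : ∀ᵐ q ∂(volume : Measure (ℝ × ℝ)).restrict (polarDomain 1),
    ‖q.1 • direction q.2‖ ≤ 1 := by
  filter_upwards [ae_restrict_mem (measurableSet_polarDomain 1)] with q hq
  rw [norm_smul_direction hq.1.1.le]
  exact hq.1.2.le

theorem integrable_planar_weight :
    Integrable (fun q : ℝ × ℝ => ((1 : ℝ) ^ 2 - q.1 ^ 2) ^ (-(1 / 2) : ℝ) * q.1)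
      ((volume : Measure (ℝ × ℝ)).restrict (polarDomain 1)) := by
  refine (integrableOn_abelKernel one_pos).mul_bdd (c := 1)
    measurable_fst.aestronglyMeasurable ?_
  filter_upwards [ae_restrict_mem (measurableSet_polarDomain 1)] with q hq
  rw [Real.norm_of_nonneg hq.1.1.le]
  exact hq.1.2.le

/-- The integral of the values of `H` at distance at most `r` against the Abel kernel. -/
def planeIntegral (H : Space 2 → ℝ) (r : ℝ) : ℝ :=
  ∫ q in polarDomain 1, (((1 : ℝ) ^ 2 - q.1 ^ 2) ^ (-(1 / 2) : ℝ) * q.1) *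
    H (r • (q.1 • direction q.2))

theorem abelIntegrable_radial (hH : ContinuousOn H (ball 0 T)) {t : ℝ} (ht0 : 0 < t) (ht : t < T) :
    AbelIntegrable t fun r θ => r * H (r • direction θ) := by
  obtain ⟨C, hC⟩ := exists_bound_closedBall hH ht
  have h1 : AEStronglyMeasurable (fun q : ℝ × ℝ => H (q.1 • direction q.2))
      (volume.restrict (polarDomain t)) := by
    have h := aestronglyMeasurable_dilation (μ := volume.restrict (polarDomain t))
      (d := fun q : ℝ × ℝ => t⁻¹ • (q.1 • direction q.2)) hH
      (measurable_planar.const_smul t⁻¹) ?_ (r := t) (by rwa [abs_of_pos ht0])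
    · simpa [smul_smul, mul_inv_cancel_left₀ ht0.ne'] using h
    · filter_upwards [ae_restrict_mem (measurableSet_polarDomain t)] with q hq
      rw [norm_smul, norm_smul_direction hq.1.1.le, Real.norm_of_nonneg (inv_nonneg.2 ht0.le),
        inv_mul_le_one₀ ht0]
      exact hq.1.2.le
  refine abelIntegrable_of_bound ht0 (C := t * C)
    (measurable_fst.aestronglyMeasurable.mul h1) fun q hq => ?_
  rw [norm_mul, Real.norm_of_nonneg hq.1.1.le]
  exact mul_le_mul hq.1.2.le (hC _ (by rw [norm_smul_direction hq.1.1.le]; exact hq.1.2.le))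
    (norm_nonneg _) ht0.le

theorem abelIntegrable_radialDeriv (hH : ContDiffOn ℝ 1 H (ball 0 T)) {t : ℝ}
    (ht : t < T) {s : ℝ} (hs0 : 0 < s) {k : ℝ} (hk : 0 ≤ k) (hks : k * s ≤ t) :
    AbelIntegrable s fun r θ => fderiv ℝ H (k • r • direction θ) (direction θ) := by
  obtain ⟨C, hC⟩ := exists_bound_closedBall (hH.continuousOn_fderiv_of_isOpen isOpen_ball le_rfl) ht
  refine abelIntegrable_of_bound hs0 (C := C) (Measurable.aestronglyMeasurable ?_) fun q hq => ?_
  · exact ContinuousLinearMap.measurable_apply₂.comp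
      (((measurable_fderiv ℝ H).comp (measurable_planar.const_smul k)).prodMk
        (continuous_direction.measurable.comp measurable_snd))
  · refine (ContinuousLinearMap.le_opNorm _ _).trans ?_
    rw [norm_direction, mul_one]
    refine hC _ ?_
    rw [smul_smul, norm_smul_direction (mul_nonneg hk hq.1.1.le)]
    exact (mul_le_mul_of_nonneg_left hq.1.2.le hk).trans hks

theorem abelIntegral_radial (hH : ContinuousOn H (ball 0 T)) {t : ℝ} (ht0 : 0 < t) (ht : t < T) :
    abelIntegral t (fun r θ => r * H (r • direction θ)) = t * planeIntegral H t := by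
  -- After rescaling to unit time the chart has radius T/t > 1, so the integrability statement
  -- applies at t = 1.
  have hcont : ContinuousOn (fun y => H (t • y)) (ball 0 (T / t)) := by
    refine hH.comp (by fun_prop) fun y hy => ?_
    have : ‖y‖ < T / t := by simpa using hy
    rw [lt_div_iff₀' ht0] at this
    simpa [norm_smul, abs_of_pos ht0] using this
  have h1 := (abelIntegrable_radial hcont one_pos ((one_lt_div ht0).2 ht)).setIntegral_eq one_pos
  rw [abelIntegral_scale ht0, planeIntegral]
  simp only [smul_smul, mul_assoc] at h1 ⊢
  rw [h1]
  simp only [abelIntegral]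
  simp only [← intervalIntegral.integral_const_mul]
  refine intervalIntegral.integral_congr fun θ _ => intervalIntegral.integral_congr fun z _ => ?_
  ring

theorem integral_gsFun_neg_half (hH : ContinuousOn H (ball 0 T)) {t : ℝ} (ht0 : 0 < t)
    (ht : t < T) :
    ∫ y in ball 0 T, gsFun (-(1 / 2) + (0 : ℕ)) (t ^ 2 - ‖y‖ ^ 2) * H y =
      1 / realFactorial (-(1 / 2)) * (t * planeIntegral H t) := by
  rw [← abelIntegral_radial hH ht0 ht, ← (abelIntegrable_radial hH ht0 ht).setIntegral_eq ht0,
    ← integral_indicator measurableSet_ball, integral_polar, ← integral_const_mul]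
  have hsub : polarDomain t ⊆ Ioi (0 : ℝ) ×ˢ Ioo 0 (2 * Real.pi) :=
    prod_mono Ioo_subset_Ioi_self subset_rfl
  rw [setIntegral_eq_of_subset_of_forall_sdiff_eq_zero
    (measurableSet_Ioi.prod measurableSet_Ioo) hsub]
  · refine setIntegral_congr_fun (measurableSet_polarDomain t) fun q hq => ?_
    have h0 : 0 ≤ q.1 := hq.1.1.le
    have hmem : q.1 • direction q.2 ∈ ball (0 : Space 2) T := by
      rw [mem_ball_zero_iff, norm_smul_direction h0]; exact hq.1.2.trans ht
    simp only [indicator_of_mem hmem, norm_smul_direction h0, gsFun_neg_half h0 ht0.le,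
      if_pos hq.1.2]
    ring
  · rintro q ⟨hq1, hq2⟩
    have h0 : 0 ≤ q.1 := le_of_lt hq1.1
    have h1 : ¬ q.1 < t := fun h => hq2 ⟨⟨hq1.1, h⟩, hq1.2⟩
    simp only [indicator, norm_smul_direction h0, gsFun_neg_half h0 ht0.le, if_neg h1]
    simp

theorem continuousAt_planeIntegral (hH : ContinuousOn H (ball 0 T)) {r : ℝ} (hr : |r| < T) :
    ContinuousAt (planeIntegral H) r :=
  continuousAt_integral_dilation hH integrable_planar_weight measurable_planar norm_planar_le hr

/-- Integration by parts along each ray. -/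
theorem hasDerivAt_mul_planeIntegral (hH : ContDiffOn ℝ 1 H (ball 0 T)) {t : ℝ} (ht0 : 0 < t)
    (ht : t < T) :
    HasDerivAt (fun r => r * planeIntegral H r) (2 * Real.pi * H 0 +
      t * abelIntegral t fun r θ => fderiv ℝ H (r • direction θ) (direction θ)) t := by
  have habs : |t| < T := by rwa [abs_of_pos ht0]
  obtain ⟨h1, h2⟩ := hasDerivAt_integral_dilation hH integrable_planar_weight measurable_planar
    norm_planar_le habs
  have h3 := integrable_mul_dilation hH.continuousOn integrable_planar_weight measurable_planar
    norm_planar_le habs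
  refine ((hasDerivAt_id t).mul h2).congr_deriv ?_
  have h4 := abelIntegrable_radialDeriv hH ht one_pos ht0.le (mul_one t).le
  -- The product rule produces the weights z and z²t on H and its radial derivative. Subtracting the
  -- claimed integral, of weight t, leaves exactly the integrand of `integral_abelKernel_by_parts`
  -- with g(z) = H(tzω); each ray contributes H(0).
  have h5 : AbelIntegrable 1 fun z θ => z * H (t • z • direction θ) +
      z ^ 2 * (t * fderiv ℝ H (t • z • direction θ) (direction θ)) -
        t * fderiv ℝ H (t • z • direction θ) (direction θ) := by
    refine ((h3.add (h1.const_mul t)).sub (h4.const_mul t)).congr (Eventually.of_forall fun q => ?_)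
    simp only [Pi.add_apply, Pi.sub_apply, map_smul, smul_eq_mul]
    ring
  have h6 := h5.setIntegral_eq one_pos
  have h7 : abelIntegral 1 (fun z θ => z * H (t • z • direction θ) +
      z ^ 2 * (t * fderiv ℝ H (t • z • direction θ) (direction θ)) -
        t * fderiv ℝ H (t • z • direction θ) (direction θ)) = 2 * Real.pi * H 0 := by
    have : ∀ θ, ∫ z in (0 : ℝ)..1, ((1 : ℝ) ^ 2 - z ^ 2) ^ (-(1 / 2) : ℝ) *
        (z * H (t • z • direction θ) +
          z ^ 2 * (t * fderiv ℝ H (t • z • direction θ) (direction θ)) -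
        t * fderiv ℝ H (t • z • direction θ) (direction θ)) = H 0 := by
      intro θ
      have hn : ∀ z ∈ Icc (0 : ℝ) 1, ‖t • z • direction θ‖ < T := fun z hz =>
        norm_smul_lt habs (by rw [norm_smul_direction hz.1]; exact hz.2)
      have h := integral_abelKernel_by_parts (g := fun z => H (t • z • direction θ))
        (g' := fun z => t * fderiv ℝ H (t • z • direction θ) (direction θ)) ?_ ?_
      · simpa using h
      · intro z hz
        have hl : HasDerivAt (fun z : ℝ => t • z • direction θ) (t • direction θ) z :=
          (hasDerivAt_smul_const (direction θ) z).const_smul t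
        refine ((hH.hasFDerivAt_ball (hn z hz)).comp_hasDerivAt z hl).congr_deriv ?_
        simp
      · refine continuousOn_const.mul (ContinuousOn.clm_apply ?_ continuousOn_const)
        exact (hH.continuousOn_fderiv_of_isOpen isOpen_ball le_rfl).comp (by fun_prop)
          fun z hz => by simpa using hn z hz
    rw [abelIntegral]
    simp only [this]
    simp
  rw [abelIntegral_scale ht0]
  have h9 : Integrable (fun q : ℝ × ℝ => ((1 : ℝ) ^ 2 - q.1 ^ 2) ^ (-(1 / 2) : ℝ) * q.1 *
      H (t • q.1 • direction q.2) + t * (((1 : ℝ) ^ 2 - q.1 ^ 2) ^ (-(1 / 2) : ℝ) * q.1 *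
        fderiv ℝ H (t • q.1 • direction q.2) (q.1 • direction q.2)))
      (volume.restrict (polarDomain 1)) := h3.add (h1.const_mul t)
  have h8 := h4.setIntegral_eq one_pos
  simp only [← smul_smul] at h8 ⊢
  rw [← h8, ← h7, ← h6, ← sub_eq_iff_eq_add, id, one_mul, ← integral_const_mul,
    ← integral_const_mul, ← integral_add h3 (h1.const_mul t), ← integral_sub h9 (h4.const_mul t)]
  refine integral_congr_ae (Eventually.of_forall fun q => ?_)
  simp only [map_smul, smul_eq_mul]
  ring

end TwoDimensions

section LeadingTwo

variable {ρ ν : Space 2 → ℝ} {x₀ : Space 2} {T : ℝ} {X : Space 2 → Space 2} {v₀ : Space 2 → ℝ}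
  (hρ : ∀ x, 0 < ρ x) (hν : ∀ x, 0 < ν x) (hρd : ContDiff ℝ 1 ρ) (hνd : ContDiff ℝ 1 ν)
  (hX : CausticFree (speed ρ ν) x₀ T X) (hX0 : X 0 = x₀) (hv : IsLeadingCoeff ρ ν x₀ T v₀)

include hρ hν hρd hνd hX hX0 hv

theorem gsPrimitive_two {φ : Space 2 → ℝ} (hφ : Continuous φ) {t : ℝ} (ht0 : 0 < t) (ht : t < T) :
    gsPrimitive (-(1 / 2)) (travelTime (speed ρ ν) x₀) (fun x => v₀ x * φ x) (t ^ 2) =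
      1 / realFactorial (-(1 / 2)) * (t * planeIntegral (pullback ρ ν x₀ X v₀ φ) t) := by
  rw [gsPrimitive, gsOrder_neg_half,
    hv.integral_eq hρ hν hρd hνd hX hX0 (gsFun_of_neg _) (ht0.trans ht) (by gcongr),
    integral_gsFun_neg_half (hv.continuousOn_pullback hρ hν hρd hνd hX hX0 hφ) ht0 ht]

theorem leadingTermRegular_two {φ : Space 2 → ℝ} (hφ : Continuous φ) {t : ℝ} (ht0 : 0 < t)
    (ht : t < T) : LeadingTermRegular (travelTime (speed ρ ν) x₀) v₀ t φ := by
  have hT := ht0.trans ht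
  have hH := hv.continuousOn_pullback hρ hν hρd hνd hX hX0 hφ
  have hmem : Ioo 0 (T ^ 2) ∈ 𝓝 (t ^ 2) :=
    isOpen_Ioo.mem_nhds ⟨by positivity, by gcongr⟩
  rw [LeadingTermRegular, leadingExponent_two, GSRegular, gsOrder_neg_half]
  constructor
  · filter_upwards [hmem] with r hr
    rw [hv.integrable_iff hρ hν hρd hνd hX hX0 (gsFun_of_neg _) hT hr.2 φ, ← Real.sq_sqrt hr.1.le]
    exact integrableOn_gsFun_neg_half hH (Real.sqrt_pos.2 hr.1) ((Real.sqrt_lt' hT).2 hr.2)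
  · rw [Nat.cast_zero, contDiffAt_zero]
    refine ⟨_, hmem, ContinuousOn.congr (f := fun s => 1 / realFactorial (-(1 / 2)) *
      (√s * planeIntegral (pullback ρ ν x₀ X v₀ φ) √s)) (fun s hs => ?_) fun s hs => ?_⟩
    · have h1 : ContinuousAt (fun s => planeIntegral (pullback ρ ν x₀ X v₀ φ) √s) s := by
        refine ContinuousAt.comp (f := fun s : ℝ => √s) (continuousAt_planeIntegral hH ?_)
          Real.continuous_sqrt.continuousAt
        rw [abs_of_nonneg (Real.sqrt_nonneg s)]
        exact (Real.sqrt_lt' hT).2 hs.2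
      exact (continuousAt_const.mul
        (Real.continuous_sqrt.continuousAt.mul h1)).continuousWithinAt
    · have h := gsPrimitive_two hρ hν hρd hνd hX hX0 hv hφ (Real.sqrt_pos.2 hs.1)
        ((Real.sqrt_lt' hT).2 hs.2)
      rwa [Real.sq_sqrt hs.1.le] at h

theorem leadingTerm_two {φ : Space 2 → ℝ} (hφ : Continuous φ) {t : ℝ} (ht0 : 0 < t)
    (ht : t < T) : leadingTerm (travelTime (speed ρ ν) x₀) v₀ t φ =
      1 / realFactorial (-(1 / 2)) * (t * planeIntegral (pullback ρ ν x₀ X v₀ φ) t) := by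
  rw [leadingTerm, gsIntegral, leadingExponent_two, gsOrder_neg_half, iteratedDeriv_zero,
    gsPrimitive_two hρ hν hρd hνd hX hX0 hv hφ ht0 ht]

theorem hasDerivAt_leadingTerm_two {u : Space 2 → ℝ} (hu : ContDiff ℝ 1 u) {t : ℝ} (ht0 : 0 < t)
    (ht : t < T) :
    HasDerivAt (fun r => leadingTerm (travelTime (speed ρ ν) x₀) v₀ r fun x => ρ x * u x)
      (u x₀ + t / realFactorial (-(1 / 2)) * abelIntegral t fun r θ =>
        fderiv ℝ (pullback ρ ν x₀ X v₀ fun x => ρ x * u x) (r • direction θ) (direction θ)) t := by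
  have h1 := (hasDerivAt_mul_planeIntegral (hv.contDiffOn_pullback hρ hν hρd hνd hX hX0 hu)
    ht0 ht).const_mul (1 / realFactorial (-(1 / 2)))
  -- Here E/v₀(x₀) = 1/(2√π), so 2πH(0) = √π u(x₀) = (-1/2)! u(x₀): the source normalization gives
  -- the term u(x₀) coefficient 1.
  have h2 : pullback ρ ν x₀ X v₀ (fun x => ρ x * u x) 0 * (2 * Real.pi) =
      realFactorial (-(1 / 2)) * u x₀ := by
    have e1 := (hρ x₀).ne'
    have e2 := (speed_pos hρ hν x₀).ne'
    have e3 : √Real.pi ≠ 0 := (Real.sqrt_pos.2 Real.pi_pos).ne'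
    have e4 := hv.source
    rw [show (((2 : ℕ) : ℝ) - 1) / 2 = 1 / 2 by norm_num, ← Real.sqrt_eq_rpow] at e4
    have e5 : energyConst ρ ν x₀ = 1 / (4 * ρ x₀ * speed ρ ν x₀ ^ 2 * Real.pi) := by
      norm_num [energyConst]
    rw [pullback, hX0, e4, e5, realFactorial_neg_half]
    have e6 := Real.sq_sqrt Real.pi_pos.le
    field_simp
    ring
  have h3 : realFactorial (-(1 / 2)) ≠ 0 := by
    rw [realFactorial_neg_half]
    exact (Real.sqrt_pos.2 Real.pi_pos).ne'
  refine (h1.congr_of_eventuallyEq ?_).congr_deriv ?_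
  · filter_upwards [isOpen_Ioo.mem_nhds (⟨ht0, ht⟩ : t ∈ Ioo 0 T)] with r hr
    exact leadingTerm_two hρ hν hρd hνd hX hX0 hv (hρd.continuous.mul hu.continuous) hr.1 hr.2
  · rw [mul_comm (2 * Real.pi), h2]
    field_simp

end LeadingTwo

theorem AbelIntegrable.congr_fun {t : ℝ} {F G : ℝ → ℝ → ℝ} (hF : AbelIntegrable t F)
    (h : ∀ r ∈ Ioo 0 t, ∀ θ, F r θ = G r θ) : AbelIntegrable t G :=
  IntegrableOn.congr_fun hF (fun q hq => by simp only [h q.1 hq.1 q.2])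
    (measurableSet_polarDomain t)

theorem abelIntegral_congr {t : ℝ} (ht : 0 < t) {F G : ℝ → ℝ → ℝ}
    (h : ∀ r ∈ Ioo 0 t, ∀ θ, F r θ = G r θ) : abelIntegral t F = abelIntegral t G := by
  refine intervalIntegral.integral_congr fun θ _ => ?_
  rw [intervalIntegral.integral_of_le ht.le, intervalIntegral.integral_of_le ht.le,
    integral_Ioc_eq_integral_Ioo, integral_Ioc_eq_integral_Ioo]
  exact setIntegral_congr_fun measurableSet_Ioo fun r hr => by simp only [h r hr θ]

/-- As in three dimensions, u is the datum under the time derivative and f = ρw the other one; the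
two choices of (u, w) yield U and V. -/
theorem hadamard_kirchhoff_huygens_two (ρ ν : Space 2 → ℝ) (hρd : ContDiff ℝ 1 ρ)
    (hνd : ContDiff ℝ 1 ν)
    (hρ : ∀ x, 0 < ρ x) (hν : ∀ x, 0 < ν x) (x₀ : Space 2) (T : ℝ) (X : Space 2 → Space 2)
    (hX : CausticFree (speed ρ ν) x₀ T X) (v₀ : Space 2 → ℝ) (hv : IsLeadingCoeff ρ ν x₀ T v₀)
    (u w f : Space 2 → ℝ) (hu : ContDiff ℝ 1 u)
    (hf : Continuous f) (hfw : ∀ x, f x = ρ x * w x)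
    (t : ℝ) (ht0 : 0 < t) (ht : t < T) :
    LeadingTermRegular (travelTime (speed ρ ν) x₀) v₀ t (fun x => ρ x * u x) ∧
    LeadingTermRegular (travelTime (speed ρ ν) x₀) v₀ t f ∧
    DifferentiableAt ℝ
      (fun r => leadingTerm (travelTime (speed ρ ν) x₀) v₀ r (fun x => ρ x * u x)) t ∧
    AbelIntegrable t (fun τ θ => τ * w (X (τ • direction θ)) /
      (4 * ρ x₀ * speed ρ ν x₀ ^ 2 * Real.pi * v₀ (X (τ • direction θ)))) ∧
    AbelIntegrable t (fun τ θ => rayDeriv ρ ν x₀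
      (fun x => u x / (4 * ρ x₀ * speed ρ ν x₀ ^ 2 * Real.pi * v₀ x)) (X (τ • direction θ))) ∧
    leadingTerm (travelTime (speed ρ ν) x₀) v₀ t f +
      deriv (fun r => leadingTerm (travelTime (speed ρ ν) x₀) v₀ r (fun x => ρ x * u x)) t =
      u x₀ + 1 / realFactorial (-(1 / 2)) *
        abelIntegral t (fun τ θ => τ * w (X (τ • direction θ)) /
          (4 * ρ x₀ * speed ρ ν x₀ ^ 2 * Real.pi * v₀ (X (τ • direction θ))))
        + t / realFactorial (-(1 / 2)) * abelIntegral t (fun τ θ => rayDeriv ρ ν x₀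
          (fun x => u x / (4 * ρ x₀ * speed ρ ν x₀ ^ 2 * Real.pi * v₀ x))
            (X (τ • direction θ))) := by
  have hX0 := hX.apply_zero
  have hd := hasDerivAt_leadingTerm_two hρ hν hρd hνd hX hX0 hv hu ht0 ht
  have hE : energyConst ρ ν x₀ = 1 / (4 * ρ x₀ * speed ρ ν x₀ ^ 2 * Real.pi) := by
    norm_num [energyConst]
  have hE0 := (energyConst_pos (x₀ := x₀) hρ hν).ne'
  have hcP := hv.contDiffOn_pullback hρ hν hρd hνd hX hX0 hu
  have hcQ := hv.continuousOn_pullback hρ hν hρd hνd hX hX0 hf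
  have hA : ∀ r ∈ Ioo 0 t, ∀ θ, r * pullback ρ ν x₀ X v₀ f (r • direction θ) =
      r * w (X (r • direction θ)) /
        (4 * ρ x₀ * speed ρ ν x₀ ^ 2 * Real.pi * v₀ (X (r • direction θ))) := by
    intro r _ θ
    rw [pullback, hfw, mul_div_mul_left _ _ (hρ _).ne', hE, div_mul_div_comm, one_mul,
      mul_div_assoc]
  have hB : ∀ r ∈ Ioo 0 t, ∀ θ,
      fderiv ℝ (pullback ρ ν x₀ X v₀ fun x => ρ x * u x) (r • direction θ) (direction θ) =
      rayDeriv ρ ν x₀ (fun x => u x / (4 * ρ x₀ * speed ρ ν x₀ ^ 2 * Real.pi * v₀ x))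
        (X (r • direction θ)) := by
    intro r hr θ
    have hk : (fun x => u x / (4 * ρ x₀ * speed ρ ν x₀ ^ 2 * Real.pi * v₀ x)) =
        fun x => energyConst ρ ν x₀ * (u x / v₀ x) := by
      funext x
      rw [hE, div_mul_div_comm, one_mul]
    rw [hk, hv.rayDeriv_eq hρ hν hρd hνd hX hX0 hu (norm_direction θ) hr.1 (hr.2.trans ht),
      div_self hE0, one_mul]
  have hBi := abelIntegrable_radialDeriv hcP ht ht0 zero_le_one (one_mul t).le
  simp only [one_smul] at hBi
  refine ⟨leadingTermRegular_two hρ hν hρd hνd hX hX0 hv (hρd.continuous.mul hu.continuous) ht0 ht,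
    leadingTermRegular_two hρ hν hρd hνd hX hX0 hv hf ht0 ht, hd.differentiableAt,
    (abelIntegrable_radial hcQ ht0 ht).congr_fun hA, hBi.congr_fun hB, ?_⟩
  rw [hd.deriv, leadingTerm_two hρ hν hρd hνd hX hX0 hv hf ht0 ht, ← abelIntegral_radial hcQ ht0 ht,
    abelIntegral_congr ht0 hA, abelIntegral_congr ht0 hB]
  ring

end

/-! ### Value and velocity formulas in both dimensions -/

theorem mainTheorem4 :
    -- two dimensions
    (∀ (ρ ν : Space 2 → ℝ), AnalyticOnNhd ℝ ρ Set.univ → AnalyticOnNhd ℝ ν Set.univ →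
      (∀ x, 0 < ρ x) → (∀ x, 0 < ν x) →
      ∀ (x₀ : Space 2) (T : ℝ) (X : Space 2 → Space 2), CausticFree (speed ρ ν) x₀ T X →
      ∀ v₀ : Space 2 → ℝ, IsLeadingCoeff ρ ν x₀ T v₀ →
      ∀ u₁ u₂ : Space 2 → ℝ, ContDiff ℝ 2 u₁ → HasCompactSupport u₁ →
        ContDiff ℝ 1 u₂ → HasCompactSupport u₂ →
      ∀ t : ℝ, 0 < t → t < T →
      let c := speed ρ ν
      let G₀ := leadingTerm (travelTime c x₀) v₀
      let A₁ : ℝ → ℝ → ℝ := fun τ θ =>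
        τ * u₂ (X (τ • direction θ)) /
          (4 * ρ x₀ * c x₀ ^ 2 * Real.pi * v₀ (X (τ • direction θ)))
      let B₁ : ℝ → ℝ → ℝ := fun τ θ =>
        rayDeriv ρ ν x₀ (fun x => u₁ x / (4 * ρ x₀ * c x₀ ^ 2 * Real.pi * v₀ x))
          (X (τ • direction θ))
      let A₂ : ℝ → ℝ → ℝ := fun τ θ =>
        τ * divGrad ν u₁ (X (τ • direction θ)) /
          (4 * ρ x₀ * ρ (X (τ • direction θ)) * c x₀ ^ 2 * Real.pi * v₀ (X (τ • direction θ)))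
      let B₂ : ℝ → ℝ → ℝ := fun τ θ =>
        rayDeriv ρ ν x₀ (fun x => u₂ x / (4 * ρ x₀ * c x₀ ^ 2 * Real.pi * v₀ x))
          (X (τ • direction θ))
      -- the generalized integrals and their time derivatives exist
      (∀ φ ∈ ({fun x => ρ x * u₁ x, fun x => ρ x * u₂ x, divGrad ν u₁} : Set (Space 2 → ℝ)),
        LeadingTermRegular (travelTime c x₀) v₀ t φ) ∧
      DifferentiableAt ℝ (fun r => G₀ r (fun x => ρ x * u₁ x)) t ∧
      DifferentiableAt ℝ (fun r => G₀ r (fun x => ρ x * u₂ x)) t ∧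
      AbelIntegrable t A₁ ∧ AbelIntegrable t B₁ ∧ AbelIntegrable t A₂ ∧ AbelIntegrable t B₂ ∧
      khValue ρ G₀ u₁ u₂ t =
        u₁ x₀ + 1 / realFactorial (-(1 / 2)) * abelIntegral t A₁
          + t / realFactorial (-(1 / 2)) * abelIntegral t B₁ ∧
      khVelocity ρ ν G₀ u₁ u₂ t =
        u₂ x₀ + 1 / realFactorial (-(1 / 2)) * abelIntegral t A₂
          + t / realFactorial (-(1 / 2)) * abelIntegral t B₂) ∧
    -- three dimensions
    (∀ (ρ ν : Space 3 → ℝ), AnalyticOnNhd ℝ ρ Set.univ → AnalyticOnNhd ℝ ν Set.univ →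
      (∀ x, 0 < ρ x) → (∀ x, 0 < ν x) →
      ∀ (x₀ : Space 3) (T : ℝ) (X : Space 3 → Space 3), CausticFree (speed ρ ν) x₀ T X →
      ∀ v₀ : Space 3 → ℝ, IsLeadingCoeff ρ ν x₀ T v₀ →
      ∀ u₁ u₂ : Space 3 → ℝ, ContDiff ℝ 2 u₁ → HasCompactSupport u₁ →
        ContDiff ℝ 1 u₂ → HasCompactSupport u₂ →
      ∀ t : ℝ, 0 < t → t < T →
      let c := speed ρ ν
      let G₀ := leadingTerm (travelTime c x₀) v₀
      let F₁ : Space 3 → ℝ := fun x =>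
        t * (u₂ x / (8 * ρ x₀ * c x₀ ^ 3 * Real.pi ^ 2 * v₀ x))
          + u₁ x / (8 * ρ x₀ * c x₀ ^ 3 * Real.pi ^ 2 * v₀ x)
          + t * rayDeriv ρ ν x₀ (fun y => u₁ y / (8 * ρ x₀ * c x₀ ^ 3 * Real.pi ^ 2 * v₀ y)) x
      let F₂ : Space 3 → ℝ := fun x =>
        t * (divGrad ν u₁ x / (8 * ρ x₀ * ρ x * c x₀ ^ 3 * Real.pi ^ 2 * v₀ x))
          + u₂ x / (8 * ρ x₀ * c x₀ ^ 3 * Real.pi ^ 2 * v₀ x)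
          + t * rayDeriv ρ ν x₀ (fun y => u₂ y / (8 * ρ x₀ * c x₀ ^ 3 * Real.pi ^ 2 * v₀ y)) x
      -- the generalized integrals and their time derivatives exist
      (∀ φ ∈ ({fun x => ρ x * u₁ x, fun x => ρ x * u₂ x, divGrad ν u₁} : Set (Space 3 → ℝ)),
        LeadingTermRegular (travelTime c x₀) v₀ t φ) ∧
      DifferentiableAt ℝ (fun r => G₀ r (fun x => ρ x * u₁ x)) t ∧
      DifferentiableAt ℝ (fun r => G₀ r (fun x => ρ x * u₂ x)) t ∧
      MeasureTheory.Integrable (fun e : Metric.sphere (0 : Space 3) 1 => F₁ (X (t • (e : Space 3)))) sphereMeasure ∧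
      MeasureTheory.Integrable (fun e : Metric.sphere (0 : Space 3) 1 => F₂ (X (t • (e : Space 3)))) sphereMeasure ∧
      khValue ρ G₀ u₁ u₂ t = ∫ e, F₁ (X (t • (e : Space 3))) ∂sphereMeasure ∧
      khVelocity ρ ν G₀ u₁ u₂ t = ∫ e, F₂ (X (t • (e : Space 3))) ∂sphereMeasure) := by
  constructor
  · intro ρ ν hρa hνa hρ hν x₀ T X hX v₀ hv u₁ u₂ hu₁ _ hu₂ _ t ht0 ht c G₀ A₁ B₁ A₂ B₂
    have hρd : ContDiff ℝ 1 ρ := hρa.contDiff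
    have hνd : ContDiff ℝ 1 ν := hνa.contDiff
    have hu₁' : ContDiff ℝ 1 u₁ := hu₁.of_le (by norm_num)
    obtain ⟨r1, r2, d1, a1, b1, e1⟩ := hadamard_kirchhoff_huygens_two ρ ν hρd hνd hρ hν x₀ T X hX
      v₀ hv u₁ u₂ _ hu₁' (hρd.continuous.mul hu₂.continuous) (fun _ => rfl) t ht0 ht
    -- The velocity is the same formula with u² under the time derivative and w = ρ⁻¹∇·(ν∇u¹), so
    -- that ρw is the continuous function ∇·(ν∇u¹).
    obtain ⟨-, r3, d2, a2, b2, e2⟩ := hadamard_kirchhoff_huygens_two ρ ν hρd hνd hρ hν x₀ T X hX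
      v₀ hv u₂ (fun x => divGrad ν u₁ x / ρ x) _ hu₂ (continuous_divGrad hνd hu₁)
      (fun x => (mul_div_cancel₀ _ (hρ x).ne').symm) t ht0 ht
    have hA₂ : (fun τ θ => τ * (divGrad ν u₁ (X (τ • direction θ)) / ρ (X (τ • direction θ))) /
        (4 * ρ x₀ * speed ρ ν x₀ ^ 2 * Real.pi * v₀ (X (τ • direction θ)))) = A₂ := by
      funext τ θ
      simp only [A₂, c]
      rw [← mul_div_assoc, div_div]
      congr 1
      ring
    rw [hA₂] at a2 e2
    refine ⟨?_, d1, d2, a1, b1, a2, b2, e1, ?_⟩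
    · rintro φ (rfl | rfl | rfl)
      exacts [r1, r2, r3]
    -- The wave equation acts on ρu¹ divided by ρ, which simplifies back to u¹.
    · rw [khVelocity, waveSecond, add_comm]
      simpa only [mul_div_cancel_left₀ _ (hρ _).ne'] using e2
  · intro ρ ν hρa hνa hρ hν x₀ T X hX v₀ hv u₁ u₂ hu₁ _ hu₂ _ t ht0 ht c G₀ F₁ F₂
    have hρd : ContDiff ℝ 1 ρ := hρa.contDiff
    have hνd : ContDiff ℝ 1 ν := hνa.contDiff
    have hu₁' : ContDiff ℝ 1 u₁ := hu₁.of_le (by norm_num)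
    obtain ⟨r1, r2, d1, i1, e1⟩ := hadamard_kirchhoff_huygens_three ρ ν hρd hνd hρ hν x₀ T X hX
      v₀ hv u₁ u₂ _ hu₁' (hρd.continuous.mul hu₂.continuous) (fun _ => rfl) t ht0 ht
    obtain ⟨-, r3, d2, i2, e2⟩ := hadamard_kirchhoff_huygens_three ρ ν hρd hνd hρ hν x₀ T X hX
      v₀ hv u₂ (fun x => divGrad ν u₁ x / ρ x) _ hu₂ (continuous_divGrad hνd hu₁)
      (fun x => (mul_div_cancel₀ _ (hρ x).ne').symm) t ht0 ht
    have hF₂ : ∀ x, t * (divGrad ν u₁ x / ρ x /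
          (8 * ρ x₀ * speed ρ ν x₀ ^ 3 * Real.pi ^ 2 * v₀ x))
        + u₂ x / (8 * ρ x₀ * speed ρ ν x₀ ^ 3 * Real.pi ^ 2 * v₀ x)
        + t * rayDeriv ρ ν x₀
          (fun y => u₂ y / (8 * ρ x₀ * speed ρ ν x₀ ^ 3 * Real.pi ^ 2 * v₀ y)) x = F₂ x := by
      intro x
      simp only [F₂, c]
      rw [div_div]
      congr 4
      ring
    simp only [hF₂] at i2 e2
    refine ⟨?_, d1, d2, i1, i2, e1, ?_⟩
    · rintro φ (rfl | rfl | rfl)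
      exacts [r1, r2, r3]
    · rw [khVelocity, waveSecond, add_comm]
      simpa only [mul_div_cancel_left₀ _ (hρ _).ne'] using e2
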